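/- **Conventions.** A *linear extension* of a finite poset $\mathcal P$ is a linear order on its elements that contains the order of $\mathcal P$. The *linear extension graph* $G(\mathcal P)$ has the linear extensions of $\mathcal P$ as vertices, two of them being adjacent if they differ in a single adjacent transposition; its diameter is the *linear extension diameter* $\mathrm{led}(\mathcal P)$. The poset $\mathcal P$ is *2-dimensional* if it has a realizer $\{L_1,L_2\}$, i.e. linear extensions $L_1,L_2$ such that $x\le y$ in $\mathcal P$ if and only if $x\le y$ in both $L_1$ and $L_2$ (so the dimension is at most $2$; chains are included). The *downset lattice* $\mathcal D_{\mathcal P}$ is the set of all downsets of $\mathcal P$, ordered by inclusion. Running times are measured on a random access machine with unit costs: a program is built from the elementary instructions "do nothing", loading a constant, addition, truncated subtraction, multiplication, integer division (with $x/0=0$), and indirect reading and writing of memory cells, by sequencing, branching and while-loops on whether a register is zero; every elementary instruction and every test takes one step. Registers and cells hold natural numbers of at most $w$ bits, and a run in which a result needs more than $w$ bits is not admitted. A poset $\mathcal P$ with $n=|\mathcal P|$ elements, listed in arbitrary order as $e_0,\dots,e_{n-1}$, is given by $n$ (in register $0$) and its $n\times n$ zero-one matrix $[e_i\le e_j]$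 (in cell $in+j$); all other registers and cells are $0$ initially. The output is read from register $0$. **Theorem.** The linear extension diameter of the downset lattice $\mathcal D_{\mathcal P}$ of a 2-dimensional poset $\mathcal P$ can be computed in time $O(|\mathcal P|^5)$: there are a fixed program, a constant $c\in\mathbb N$ and a function $T:\mathbb N\to\mathbb N$ with $T(n)=O(n^5)$ such that for every $n\ge 0$, every 2-dimensional poset $\mathcal P$ with $n$ elements and every listing of its elements, the program, run with words of $c(n+1)$ bits on the input $\mathcal P$, halts after at most $T(n)$ steps with output $\mathrm{led}(\mathcal D_{\mathcal P})$. -/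

import Mathlib

open scoped Asymptotics

/-! ### Linear extensions, the linear extension graph and its diameter -/

/-- A linear extension of the poset `α`: a linear order `rel` on `α` that contains `≤`. -/
@[ext]
structure LinExt (α : Type*) [PartialOrder α] where
  /-- `rel x y` says that `x` equals `y` or comes before `y`. -/
  rel : α → α → Prop
  isLinearOrder : IsLinearOrder α rel
  rel_of_le : ∀ x y : α, x ≤ y → rel x y

namespace LinExt

/-- `y` is the immediate successor of `x` in the linear extension `L`. -/
def Consecutive {α : Type*} [PartialOrder α] (L : LinExt α) (x y : α) : Prop :=
  x ≠ y ∧ L.rel x y ∧ ∀ z, L.rel x z → L.rel z y → z = x ∨ z = y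

open Classical in
/-- `M` arises from `L` by exchanging the positions of two consecutive elements of `L`. -/
def AdjacentTransposition {α : Type*} [PartialOrder α] (L M : LinExt α) : Prop :=
  ∃ x y : α, L.Consecutive x y ∧
    ∀ a b : α, M.rel a b ↔ L.rel (Equiv.swap x y a) (Equiv.swap x y b)

theorem AdjacentTransposition.symm {α : Type*} [PartialOrder α] {L M : LinExt α}
    (h : L.AdjacentTransposition M) : M.AdjacentTransposition L := by
  classical
  obtain ⟨x, y, ⟨hne, hxy, hz⟩, hM⟩ := h
  refine ⟨y, x, ⟨hne.symm, ?_, ?_⟩, ?_⟩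
  · rw [hM]
    simpa using hxy
  · intro z h1 h2
    rw [hM] at h1 h2
    simp only [Equiv.swap_apply_left, Equiv.swap_apply_right] at h1 h2
    rcases hz _ h1 h2 with h | h
    · left
      rw [Equiv.swap_apply_eq_iff] at h
      simpa using h
    · right
      rw [Equiv.swap_apply_eq_iff] at h
      simpa using h
  · intro a b
    rw [hM, Equiv.swap_comm y x]
    simp

theorem not_adjacentTransposition_self {α : Type*} [PartialOrder α] (L : LinExt α) :
    ¬ L.AdjacentTransposition L := by
  classical
  rintro ⟨x, y, ⟨hne, hxy, -⟩, hM⟩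
  have h : L.rel y x := by
    rw [hM]
    simpa using hxy
  exact hne (L.isLinearOrder.antisymm x y hxy h)

end LinExt

/-- The linear extension graph of `α`: its vertices are the linear extensions of `α`, and two of
them are adjacent if they differ in a single adjacent transposition. -/
def linExtGraph (α : Type*) [PartialOrder α] : SimpleGraph (LinExt α) where
  Adj L M := L.AdjacentTransposition M
  symm := ⟨fun _ _ h => h.symm⟩
  loopless := ⟨fun L h => L.not_adjacentTransposition_self h⟩

/-- The linear extension diameter of `α`: the diameter of its linear extension graph, as an
extended natural number (it is `⊤` if the distances in the graph are unbounded or infinite). -/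
noncomputable def led (α : Type*) [PartialOrder α] : ℕ∞ :=
  (linExtGraph α).ediam

/-! ### Two-dimensional posets -/

/-- `R` is a realizer of `α`: the order of `α` is the intersection of the linear extensions
in `R`. -/
def IsRealizer {α : Type*} [PartialOrder α] (R : Set (LinExt α)) : Prop :=
  ∀ x y : α, x ≤ y ↔ ∀ L ∈ R, L.rel x y

/-- `α` has a realizer `{L₁, L₂}`, i.e. its dimension is at most two (`L₁ = L₂` is allowed, so
that chains are included). -/
def IsTwoDimensional (α : Type*) [PartialOrder α] : Prop :=
  ∃ L₁ L₂ : LinExt α, IsRealizer {L₁, L₂}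

/-! ### Random access machines

A random access machine with finitely many named registers and an array of memory cells that is
addressed indirectly; registers and cells hold natural numbers of at most `w` bits. -/

/-- The contents of the registers and of the memory cells. -/
structure RamState where
  reg : ℕ → ℕ
  mem : ℕ → ℕ

/-- The arithmetic operations of the machine. -/
inductive RamOp where
  | add
  | sub
  | mul
  | div

/-- The values of the operations: sum, truncated difference, product and rounded-down quotient
(a quotient with divisor zero is zero). -/
def RamOp.eval : RamOp → ℕ → ℕ → ℕ
  | .add, x, y => x + y
  | .sub, x, y => x - y
  | .mul, x, y => x * y
  | .div, x, y => x / y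

/-- Programs. The natural numbers `d`, `a`, `b`, `r` are names of registers. -/
inductive RamProg where
  /-- do nothing -/
  | skip : RamProg
  /-- `d := k` for a constant `k` -/
  | const (d k : ℕ) : RamProg
  /-- `d := a ∘ b` for an arithmetic operation `∘` -/
  | op (o : RamOp) (d a b : ℕ) : RamProg
  /-- `d := mem[a]` -/
  | load (d a : ℕ) : RamProg
  /-- `mem[a] := b` -/
  | store (a b : ℕ) : RamProg
  /-- first `p`, then `q` -/
  | seq (p q : RamProg) : RamProg
  /-- if `r ≠ 0` then `p` else `q` -/
  | ite (r : ℕ) (p q : RamProg) : RamProg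
  /-- while `r ≠ 0` do `p` -/
  | loop (r : ℕ) (p : RamProg) : RamProg

/-- `p.Exec w s t s'`: on a machine with words of `w` bits, the program `p`, started in the
state `s`, halts in the state `s'` after exactly `t` steps. Each elementary instruction and each
test of a register takes one step. An instruction whose result does not fit into a word has no
successor state, so that a run that overflows is not a run. -/
inductive RamProg.Exec (w : ℕ) : RamProg → RamState → ℕ → RamState → Prop where
  | skip (s : RamState) : Exec w .skip s 1 s
  | const (d k : ℕ) (s : RamState) (h : k < 2 ^ w) :
      Exec w (.const d k) s 1 ⟨Function.update s.reg d k, s.mem⟩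
  | op (o : RamOp) (d a b : ℕ) (s : RamState) (h : o.eval (s.reg a) (s.reg b) < 2 ^ w) :
      Exec w (.op o d a b) s 1
        ⟨Function.update s.reg d (o.eval (s.reg a) (s.reg b)), s.mem⟩
  | load (d a : ℕ) (s : RamState) :
      Exec w (.load d a) s 1 ⟨Function.update s.reg d (s.mem (s.reg a)), s.mem⟩
  | store (a b : ℕ) (s : RamState) :
      Exec w (.store a b) s 1 ⟨s.reg, Function.update s.mem (s.reg a) (s.reg b)⟩
  | seq {p q : RamProg} {s s' s'' : RamState} {t t' : ℕ}
      (hp : Exec w p s t s') (hq : Exec w q s' t' s'') : Exec w (.seq p q) s (t + t') s''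
  | ite_pos {r : ℕ} {p q : RamProg} {s s' : RamState} {t : ℕ}
      (hr : s.reg r ≠ 0) (hp : Exec w p s t s') : Exec w (.ite r p q) s (1 + t) s'
  | ite_neg {r : ℕ} {p q : RamProg} {s s' : RamState} {t : ℕ}
      (hr : s.reg r = 0) (hq : Exec w q s t s') : Exec w (.ite r p q) s (1 + t) s'
  | loop_pos {r : ℕ} {p : RamProg} {s s' s'' : RamState} {t t' : ℕ}
      (hr : s.reg r ≠ 0) (hp : Exec w p s t s') (hl : Exec w (.loop r p) s' t' s'') :
      Exec w (.loop r p) s (1 + t + t') s''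
  | loop_neg {r : ℕ} {p : RamProg} {s : RamState}
      (hr : s.reg r = 0) : Exec w (.loop r p) s 1 s

/-- The machine is deterministic: the running time and the final state are determined by the
initial state. -/
theorem RamProg.Exec.deterministic {w : ℕ} {p : RamProg} {s s₁ s₂ : RamState} {t₁ t₂ : ℕ}
    (h₁ : p.Exec w s t₁ s₁) (h₂ : p.Exec w s t₂ s₂) : t₁ = t₂ ∧ s₁ = s₂ := by
  induction h₁ generalizing t₂ s₂ with
  | skip | const | op | load | store => cases h₂; exact ⟨rfl, rfl⟩
  | seq _ _ ihp ihq =>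
    cases h₂ with
    | seq hp hq =>
      obtain ⟨rfl, rfl⟩ := ihp hp
      obtain ⟨rfl, rfl⟩ := ihq hq
      exact ⟨rfl, rfl⟩
  | ite_pos hr _ ih =>
    cases h₂ with
    | ite_pos _ hp =>
      obtain ⟨rfl, rfl⟩ := ih hp
      exact ⟨rfl, rfl⟩
    | ite_neg hr' _ => exact absurd hr' hr
  | ite_neg hr _ ih =>
    cases h₂ with
    | ite_pos hr' _ => exact absurd hr hr'
    | ite_neg _ hq =>
      obtain ⟨rfl, rfl⟩ := ih hq
      exact ⟨rfl, rfl⟩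
  | loop_pos hr _ _ ihp ihl =>
    cases h₂ with
    | loop_pos _ hp hl =>
      obtain ⟨rfl, rfl⟩ := ihp hp
      obtain ⟨rfl, rfl⟩ := ihl hl
      exact ⟨rfl, rfl⟩
    | loop_neg hr' => exact absurd hr' hr
  | loop_neg hr =>
    cases h₂ with
    | loop_pos hr' _ _ => exact absurd hr hr'
    | loop_neg _ => exact ⟨rfl, rfl⟩

open Classical in
/-- The initial state for a poset whose elements are listed as `e 0, …, e (n - 1)`, in any order:
register `0` holds `n`, the cell `i * n + j` with `i, j < n` holds `1` if `e i ≤ e j` and `0`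
otherwise, and all other registers and cells hold `0`. -/
noncomputable def posetInput {α : Type*} [PartialOrder α] {n : ℕ} (e : Fin n ≃ α) : RamState where
  reg r := if r = 0 then n else 0
  mem a := if ∃ i j : Fin n, a = (i : ℕ) * n + (j : ℕ) ∧ e i ≤ e j then 1 else 0

/-! ### Distances in the linear extension graph -/

/-! The distance of two linear extensions is the number of their inversions, so the diameter is the
largest number of inversions of a pair. In the downset lattice, sort the pairs (A, B) by the
interval from A ⊓ B to A ⊔ B. The pairs belonging to one interval form a sublattice of the product
of the lattice with its dual. A linear extension picks one of (A, B) and (B, A), hence half of the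
pairs of a nontrivial interval, and the half it picks is a downset of that sublattice. By Kleitman's
inequality two such halves are positively correlated, so two linear extensions disagree, in a given
direction, on at most a quarter of the pairs (`four_mul_card_complPairs_filter_le`).

Two-dimensionality gives a conjugate order Q, a transitive orientation of incomparability, read as
"to the left of". Comparing downsets at the last element of their symmetric difference, once with
respect to ≤ ∪ Q and once with respect to ≤ ∪ `flip Q`, gives two linear extensions that invert at
least a quarter of the pairs of every interval in which any two linear extensions have an inversion
(`card_inversions_fiber_le`). Hence they form a diametral pair.

An inversion of this pair has two last differing elements, m₂ to the left of m₁. It amounts to an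
independent choice of a downset among the elements right of m₂ and not above m₁, and of one among
the elements left of m₁ and not above m₂ (`ncard_inversions_colex`). The numbers of such downsets
satisfy a recursion on the leftmost maximal element (`downsetCount_eq`).

A conjugate order is found greedily: apply forcing and transitivity, and when nothing more follows,
orient any undecided pair. No choice is ever wrong, since a closed partial orientation extends with
either orientation of an undecided edge (`IsConjugateOrder.exists_extension`, from the triangle
lemma for implication classes). At most n² rounds over n³ triples give n⁵; the counting costs only
n⁴. All numbers are at most n²4ⁿ or of the size of an address, so words of linear length suffice.
The algorithm is written in a small array language with a weakest precondition calculus that is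
sound for its compilation. -/

namespace LinExt

variable {X : Type*} [PartialOrder X]

theorem refl (L : LinExt X) (x : X) : L.rel x x := L.rel_of_le x x le_rfl

theorem antisymm (L : LinExt X) {x y : X} (h : L.rel x y) (h' : L.rel y x) : x = y :=
  L.isLinearOrder.antisymm x y h h'

theorem trans (L : LinExt X) {x y z : X} (h : L.rel x y) (h' : L.rel y z) : L.rel x z :=
  L.isLinearOrder.trans x y z h h'

theorem total (L : LinExt X) (x y : X) : L.rel x y ∨ L.rel y x := L.isLinearOrder.total x y

/-- The pairs that appear in this order in `L` and in the opposite order in `M`. -/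
def inversions (L M : LinExt X) : Set (X × X) :=
  {p | p.1 ≠ p.2 ∧ L.rel p.1 p.2 ∧ M.rel p.2 p.1}

theorem inversions_subset_union (L M N : LinExt X) :
    inversions L N ⊆ inversions L M ∪ inversions M N := by
  rintro ⟨a, b⟩ ⟨hne, h1, h2⟩
  rcases M.total a b with h | h
  · exact Or.inr ⟨hne, h, h2⟩
  · exact Or.inl ⟨hne, h1, h⟩

theorem eq_of_inversions_eq_empty {L M : LinExt X} (h : inversions L M = ∅) : L = M := by
  have key : ∀ a b, a ≠ b → L.rel a b → M.rel a b := by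
    intro a b hne hab
    by_contra hM
    have : (a, b) ∈ inversions L M := ⟨hne, hab, (M.total a b).resolve_left hM⟩
    simp [h] at this
  ext a b
  by_cases hab : a = b
  · subst hab
    exact ⟨fun _ => M.refl a, fun _ => L.refl a⟩
  · refine ⟨key a b hab, fun hM => ?_⟩
    by_contra hL
    exact hab (M.antisymm hM (key b a (Ne.symm hab) ((L.total a b).resolve_left hL)))

open Classical in
/-- Exchanging two consecutive elements `x` and `y` does not affect other pairs. -/
theorem Consecutive.rel_swap_iff {L : LinExt X} {x y : X} (h : L.Consecutive x y) {a b : X}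
    (hab : ¬ (a = x ∧ b = y)) (hba : ¬ (a = y ∧ b = x)) :
    L.rel (Equiv.swap x y a) (Equiv.swap x y b) ↔ L.rel a b := by
  obtain ⟨hne, hxy, hz⟩ := h
  have hl : ∀ c, c ≠ x → c ≠ y → (L.rel c x ↔ L.rel c y) := by
    intro c hcx hcy
    refine ⟨fun h => L.trans h hxy, fun h => ?_⟩
    rcases L.total c x with h' | h'
    · exact h'
    · rcases hz c h' h with h'' | h'' <;> contradiction
  have hr : ∀ c, c ≠ x → c ≠ y → (L.rel y c ↔ L.rel x c) := by
    intro c hcx hcy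
    refine ⟨fun h => L.trans hxy h, fun h => ?_⟩
    rcases L.total y c with h' | h'
    · exact h'
    · rcases hz c h h' with h'' | h'' <;> contradiction
  by_cases hax : a = x
  · subst hax
    by_cases hbx : b = a
    · subst hbx
      simp [L.refl]
    · have hby : b ≠ y := fun h => hab ⟨rfl, h⟩
      rw [Equiv.swap_apply_left, Equiv.swap_apply_of_ne_of_ne hbx hby, hr b hbx hby]
  · by_cases hay : a = y
    · subst hay
      by_cases hby : b = a
      · subst hby
        simp [L.refl]
      · have hbx : b ≠ x := fun h => hba ⟨rfl, h⟩
        rw [Equiv.swap_apply_right, Equiv.swap_apply_of_ne_of_ne hbx hby, hr b hbx hby]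
    · rw [Equiv.swap_apply_of_ne_of_ne hax hay]
      by_cases hbx : b = x
      · subst hbx
        rw [Equiv.swap_apply_left, hl a hax hay]
      · by_cases hby : b = y
        · subst hby
          rw [Equiv.swap_apply_right, hl a hax hay]
        · rw [Equiv.swap_apply_of_ne_of_ne hbx hby]

theorem AdjacentTransposition.encard_inversions_le {L M : LinExt X}
    (h : L.AdjacentTransposition M) : (inversions L M).encard ≤ 1 := by
  classical
  obtain ⟨x, y, hc, hM⟩ := h
  have : inversions L M ⊆ {(x, y)} := by
    rintro ⟨a, b⟩ ⟨hne, h1, h2⟩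
    by_contra hab
    have hab' : ¬ (a = x ∧ b = y) := by simpa using hab
    by_cases hba : a = y ∧ b = x
    · obtain ⟨rfl, rfl⟩ := hba
      exact hc.1 (L.antisymm hc.2.1 h1)
    · have h2' : L.rel b a := by
        have := (hM b a).1 h2
        refine (hc.rel_swap_iff ?_ ?_).1 this
        · rintro ⟨rfl, rfl⟩; exact hba ⟨rfl, rfl⟩
        · rintro ⟨rfl, rfl⟩; exact hab' ⟨rfl, rfl⟩
      exact hne (L.antisymm h1 h2')
  exact (Set.encard_le_encard this).trans (by simp)

/-- An edge of the walk changes the relative order of the exchanged pair only, and inversions are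
subadditive along the walk. -/
theorem encard_inversions_le_length {L M : LinExt X} (w : (linExtGraph X).Walk L M) :
    (inversions L M).encard ≤ w.length := by
  induction w with
  | nil =>
    have : ∀ L : LinExt X, inversions L L = ∅ := by
      intro L
      ext ⟨a, b⟩
      simp only [Set.mem_empty_iff_false, iff_false]
      rintro ⟨hne, h1, h2⟩
      exact hne (L.antisymm h1 h2)
    simp [this]
  | @cons u v w' hadj p ih =>
    have h1 : (inversions u v).encard ≤ 1 :=
      AdjacentTransposition.encard_inversions_le hadj
    calc (inversions u w').encard ≤ (inversions u v ∪ inversions v w').encard :=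
          Set.encard_le_encard (inversions_subset_union _ _ _)
      _ ≤ (inversions u v).encard + (inversions v w').encard := Set.encard_union_le _ _
      _ ≤ 1 + p.length := add_le_add h1 ih
      _ = _ := by simp [add_comm]

/-- Two different linear extensions have an inversion of consecutive elements. -/
theorem exists_consecutive_inversion [Finite X] {L M : LinExt X} (h : (inversions L M).Nonempty) :
    ∃ x y, L.Consecutive x y ∧ M.rel y x := by
  obtain ⟨⟨x, y⟩, hp, hmin⟩ := Set.exists_min_image (inversions L M)
    (fun p => {z | L.rel p.1 z ∧ L.rel z p.2}.ncard) (Set.toFinite _) h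
  refine ⟨x, y, ⟨hp.1, hp.2.1, fun z h1 h2 => ?_⟩, hp.2.2⟩
  by_contra hz
  push Not at hz
  -- The inversion has the smallest possible `L`-interval. An element z strictly inside would give
  -- the smaller inversion (x, z) or (z, y), depending on the place of z in `M`.
  rcases M.total z x with h | h
  · have := hmin (x, z) ⟨Ne.symm hz.1, h1, h⟩
    refine absurd this (not_le.2 (Set.ncard_lt_ncard ?_ (Set.toFinite _)))
    refine ⟨fun u hu => ⟨hu.1, L.trans hu.2 h2⟩, fun hsub => ?_⟩
    have : y ∈ {u | L.rel x u ∧ L.rel u z} := hsub ⟨hp.2.1, L.refl y⟩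
    exact hz.2 (L.antisymm h2 this.2)
  · have := hmin (z, y) ⟨hz.2, h2, M.trans hp.2.2 h⟩
    refine absurd this (not_le.2 (Set.ncard_lt_ncard ?_ (Set.toFinite _)))
    refine ⟨fun u hu => ⟨L.trans h1 hu.1, hu.2⟩, fun hsub => ?_⟩
    have : x ∈ {u | L.rel z u ∧ L.rel u y} := hsub ⟨L.refl x, hp.2.1⟩
    exact hz.1 (L.antisymm this.1 h1)

open Classical in
/-- Exchanging two consecutive elements of `L` that are incomparable. -/
noncomputable def swapConsecutive (L : LinExt X) (x y : X) (h : L.Consecutive x y)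
    (hxy : ¬ x ≤ y) : LinExt X where
  rel a b := L.rel (Equiv.swap x y a) (Equiv.swap x y b)
  isLinearOrder :=
    { refl := fun a => L.refl _
      trans := fun a b c h1 h2 => L.trans h1 h2
      antisymm := fun a b h1 h2 => (Equiv.swap x y).injective (L.antisymm h1 h2)
      total := fun a b => L.total _ _ }
  rel_of_le a b hab := by
    refine (h.rel_swap_iff ?_ ?_).2 (L.rel_of_le _ _ hab)
    · rintro ⟨rfl, rfl⟩; exact hxy hab
    · rintro ⟨rfl, rfl⟩; exact h.1 (L.antisymm h.2.1 (L.rel_of_le _ _ hab))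

/-- Bubble sort: a consecutive inversion consists of incomparable elements, as `L` and `M` disagree
on it, so it can be exchanged. This removes the inversion and creates no new one. -/
theorem edist_le_ncard_inversions [Finite X] (L M : LinExt X) :
    (linExtGraph X).edist L M ≤ (inversions L M).ncard := by
  induction hk : (inversions L M).ncard using Nat.strong_induction_on generalizing L with
  | _ k ih =>
  subst hk
  rcases (inversions L M).eq_empty_or_nonempty with h0 | h0
  · obtain rfl := eq_of_inversions_eq_empty h0
    simp
  · obtain ⟨x, y, hc, hM⟩ := exists_consecutive_inversion h0
    have hxy : ¬ x ≤ y := fun h => hc.1 (M.antisymm (M.rel_of_le _ _ h) hM)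
    set L' := L.swapConsecutive x y hc hxy with hL'
    have hadj : (linExtGraph X).Adj L L' := ⟨x, y, hc, fun a b => Iff.rfl⟩
    have hlt : (inversions L' M).ncard < (inversions L M).ncard := by
      refine Set.ncard_lt_ncard ?_ (Set.toFinite _)
      rw [Set.ssubset_iff_of_subset]
      · refine ⟨(x, y), ⟨hc.1, hc.2.1, hM⟩, fun h => hc.1 (L.antisymm hc.2.1 ?_)⟩
        have := h.2.1
        simpa [hL', swapConsecutive] using this
      · rintro ⟨a, b⟩ ⟨hne, h1, h2⟩
        by_cases hab : a = x ∧ b = y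
        · obtain ⟨rfl, rfl⟩ := hab
          exact ⟨hne, hc.2.1, hM⟩
        by_cases hba : a = y ∧ b = x
        · obtain ⟨rfl, rfl⟩ := hba
          exact absurd (M.antisymm hM h2) hne
        exact ⟨hne, (hc.rel_swap_iff hab hba).1 h1, h2⟩
    calc (linExtGraph X).edist L M ≤ (linExtGraph X).edist L L' + (linExtGraph X).edist L' M :=
          SimpleGraph.edist_triangle
      _ ≤ 1 + (inversions L' M).ncard :=
          add_le_add (SimpleGraph.edist_eq_one_iff_adj.2 hadj).le (ih _ hlt L' rfl)
      _ ≤ _ := by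
          rw [add_comm]
          exact_mod_cast hlt

/-- The distance of two linear extensions is the number of their inversions. -/
theorem edist_eq_ncard_inversions [Finite X] (L M : LinExt X) :
    (linExtGraph X).edist L M = (inversions L M).ncard := by
  refine le_antisymm (edist_le_ncard_inversions L M) ?_
  rw [SimpleGraph.edist_eq_sInf]
  refine le_sInf ?_
  rintro _ ⟨w, rfl⟩
  rw [(Set.toFinite (inversions L M)).cast_ncard_eq]
  exact encard_inversions_le_length w

theorem led_eq_of_isMax [Finite X] (L M : LinExt X)
    (h : ∀ L' M' : LinExt X, (inversions L' M').ncard ≤ (inversions L M).ncard) :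
    led X = (inversions L M).ncard := by
  refine le_antisymm (SimpleGraph.ediam_le_of_edist_le fun L' M' => ?_) ?_
  · rw [edist_eq_ncard_inversions]
    exact_mod_cast h L' M'
  · rw [← edist_eq_ncard_inversions]
    exact SimpleGraph.edist_le_ediam

end LinExt

/-! ### Conjugate orders -/

/-- `Q` is a transitive orientation of the incomparability graph of `α`. -/
structure IsConjugateOrder {α : Type*} [PartialOrder α] (Q : α → α → Prop) : Prop where
  not_le : ∀ {x y}, Q x y → ¬ x ≤ y
  not_ge : ∀ {x y}, Q x y → ¬ y ≤ x
  total : ∀ {x y}, ¬ x ≤ y → ¬ y ≤ x → Q x y ∨ Q y x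
  asymm : ∀ {x y}, Q x y → ¬ Q y x
  trans : ∀ {x y z}, Q x y → Q y z → Q x z

namespace IsConjugateOrder

variable {α : Type*} [PartialOrder α] {Q : α → α → Prop}

theorem flip (hQ : IsConjugateOrder Q) : IsConjugateOrder (flip Q) where
  not_le h := hQ.not_ge h
  not_ge h := hQ.not_le h
  total h h' := (hQ.total h h').symm
  asymm h h' := hQ.asymm h h'
  trans h h' := hQ.trans h' h

theorem irrefl (hQ : IsConjugateOrder Q) (x : α) : ¬ Q x x := fun h => hQ.not_le h le_rfl

/-- The strict linear order that is the union of the order and a conjugate order. -/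
def _root_.conjLT (Q : α → α → Prop) (x y : α) : Prop := x < y ∨ Q x y

theorem lt_irrefl (hQ : IsConjugateOrder Q) (x : α) : ¬ conjLT Q x x := by
  rintro (h | h)
  · exact _root_.lt_irrefl x h
  · exact hQ.irrefl x h

theorem lt_trichotomy (hQ : IsConjugateOrder Q) (x y : α) : conjLT Q x y ∨ x = y ∨ conjLT Q y x := by
  by_cases h : x ≤ y
  · rcases h.lt_or_eq with h | h
    · exact Or.inl (Or.inl h)
    · exact Or.inr (Or.inl h)
  · by_cases h' : y ≤ x
    · rcases h'.lt_or_eq with h' | h'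
      · exact Or.inr (Or.inr (Or.inl h'))
      · exact Or.inr (Or.inl h'.symm)
    · rcases hQ.total h h' with h | h
      · exact Or.inl (Or.inr h)
      · exact Or.inr (Or.inr (Or.inr h))

/-- Only the mixed cases need an argument: if x and z were in any other relation, transitivity of
the order or of `Q` would make two comparable elements incomparable or conversely. -/
theorem lt_trans (hQ : IsConjugateOrder Q) {x y z : α} (h : conjLT Q x y) (h' : conjLT Q y z) :
    conjLT Q x z := by
  rcases h with h | h <;> rcases h' with h' | h'
  · exact Or.inl (h.trans h')
  · rcases hQ.lt_trichotomy x z with h1 | rfl | h1 | h1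
    · exact h1
    · exact absurd h.le (hQ.not_ge h')
    · exact absurd (h1.trans h).le (hQ.not_ge h')
    · exact absurd h.le (hQ.not_ge (hQ.trans h' h1))
  · rcases hQ.lt_trichotomy x z with h1 | rfl | h1 | h1
    · exact h1
    · exact absurd h'.le (hQ.not_ge h)
    · exact absurd (h'.trans h1).le (hQ.not_ge h)
    · exact absurd h'.le (hQ.not_ge (hQ.trans h1 h))
  · exact Or.inr (hQ.trans h h')

theorem exists_max [Finite α] (hQ : IsConjugateOrder Q) {s : Set α} (hs : s.Nonempty) :
    ∃ m ∈ s, ∀ z, conjLT Q m z → z ∉ s := by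
  have : IsTrans α (Function.swap (conjLT Q)) := ⟨fun _ _ _ h h' => hQ.lt_trans h' h⟩
  have : Std.Irrefl (Function.swap (conjLT Q)) := ⟨fun x => hQ.lt_irrefl x⟩
  have hwf : WellFounded (Function.swap (conjLT Q)) := Finite.wellFounded_of_trans_of_irrefl _
  exact ⟨hwf.min s hs, hwf.min_mem s hs, fun z hz hzs => hwf.not_lt_min s hzs hz⟩

/-- The linear order on downsets that looks at the last element of the symmetric difference. -/
def _root_.colexRel (Q : α → α → Prop) (A B : LowerSet α) : Prop :=
  ∃ m, m ∈ B ∧ m ∉ A ∧ ∀ z, conjLT Q m z → (z ∈ A ↔ z ∈ B)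

theorem colexRel_asymm (hQ : IsConjugateOrder Q) {A B : LowerSet α} (h : colexRel Q A B) :
    ¬ colexRel Q B A := by
  rintro ⟨m', h1', h2', h3'⟩
  obtain ⟨m, h1, h2, h3⟩ := h
  rcases hQ.lt_trichotomy m m' with h | rfl | h
  · exact h2' ((h3 _ h).1 h1')
  · exact h2 h1'
  · exact h2 ((h3' _ h).1 h1)

theorem colexRel_trans (hQ : IsConjugateOrder Q) {A B C : LowerSet α} (h : colexRel Q A B)
    (h' : colexRel Q B C) : colexRel Q A C := by
  obtain ⟨m, h1, h2, h3⟩ := h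
  obtain ⟨m', h1', h2', h3'⟩ := h'
  rcases hQ.lt_trichotomy m m' with h | rfl | h
  · refine ⟨m', h1', fun hA => h2' ((h3 _ h).1 hA), fun z hz => ?_⟩
    rw [h3 z (hQ.lt_trans h hz), h3' z hz]
  · exact absurd h1 h2'
  · refine ⟨m, (h3' _ h).1 h1, h2, fun z hz => ?_⟩
    rw [h3 z hz, h3' z (hQ.lt_trans h hz)]

theorem colexRel_total [Finite α] (hQ : IsConjugateOrder Q) {A B : LowerSet α} (h : A ≠ B) :
    colexRel Q A B ∨ colexRel Q B A := by
  have hne : {z | ¬ (z ∈ A ↔ z ∈ B)}.Nonempty := by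
    by_contra hcon
    refine h (SetLike.ext fun z => ?_)
    by_contra hz
    exact hcon ⟨z, hz⟩
  obtain ⟨m, hm, hmax⟩ := hQ.exists_max hne
  simp only [Set.mem_ofPred_eq, not_not] at hmax hm
  by_cases hA : m ∈ A
  · exact Or.inr ⟨m, hA, by tauto, fun z hz => (hmax z hz).symm⟩
  · exact Or.inl ⟨m, by tauto, hA, hmax⟩

/-- The linear extension of the downset lattice given by a conjugate order. -/
def colex [Finite α] (hQ : IsConjugateOrder Q) : LinExt (LowerSet α) where
  rel A B := A = B ∨ colexRel Q A B
  isLinearOrder :=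
    { refl := fun A => Or.inl rfl
      trans := by
        rintro A B C (rfl | h) (rfl | h')
        · exact Or.inl rfl
        · exact Or.inr h'
        · exact Or.inr h
        · exact Or.inr (hQ.colexRel_trans h h')
      antisymm := by
        rintro A B (rfl | h) (h' | h')
        · rfl
        · rfl
        · exact h'.symm
        · exact absurd h' (hQ.colexRel_asymm h)
      total := by
        intro A B
        by_cases h : A = B
        · exact Or.inl (Or.inl h)
        · exact (hQ.colexRel_total h).imp Or.inr Or.inr }
  rel_of_le A B h := by
    by_cases hAB : A = B
    · exact Or.inl hAB
    · rcases hQ.colexRel_total hAB with h' | ⟨m, h1, h2, -⟩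
      · exact Or.inr h'
      · exact absurd (h h1) h2

theorem mem_inversions_colex [Finite α] (hQ : IsConjugateOrder Q) {A B : LowerSet α} :
    (A, B) ∈ LinExt.inversions hQ.colex hQ.flip.colex ↔
      colexRel Q A B ∧ colexRel (_root_.flip Q) B A := by
  constructor
  · rintro ⟨hne, h1, h2⟩
    exact ⟨h1.resolve_left hne, h2.resolve_left (Ne.symm hne)⟩
  · rintro ⟨h1, h2⟩
    refine ⟨?_, Or.inr h1, Or.inr h2⟩
    rintro h
    obtain rfl : A = B := h
    exact hQ.colexRel_asymm h1 h1

end IsConjugateOrder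

/-! ### Optimality of the colexicographic pair -/

section Fibers

variable {X : Type*} [DistribLattice X] [Fintype X] [DecidableEq X]

/-- The pairs of relative complements in the interval from `D` to `U`. -/
def complPairs (D U : X) : Finset (X × X) :=
  {p | p.1 ⊓ p.2 = D ∧ p.1 ⊔ p.2 = U}

theorem mem_complPairs {D U A B : X} : (A, B) ∈ complPairs D U ↔ A ⊓ B = D ∧ A ⊔ B = U := by
  simp [complPairs]

theorem swap_mem_complPairs {D U A B : X} (h : (A, B) ∈ complPairs D U) :
    (B, A) ∈ complPairs D U := by
  rw [mem_complPairs] at h ⊢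
  rwa [inf_comm, sup_comm]

/-- This is where distributivity enters: the complementary pairs of an interval are closed under the
meet of the product of the lattice with its dual, and by exchanging the two components also under
the join. -/
theorem inf_sup_mem_complPairs {D U A B A' B' : X} (h : (A, B) ∈ complPairs D U)
    (h' : (A', B') ∈ complPairs D U) : (A ⊓ A', B ⊔ B') ∈ complPairs D U := by
  rw [mem_complPairs] at h h' ⊢
  obtain ⟨h1, h2⟩ := h
  obtain ⟨h1', h2'⟩ := h'
  have hA : A ≤ U := h2 ▸ le_sup_left
  have hA' : A' ≤ U := h2' ▸ le_sup_left
  have hB : B ≤ U := h2 ▸ le_sup_right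
  have hB' : B' ≤ U := h2' ▸ le_sup_right
  have hD : D ≤ A := h1 ▸ inf_le_left
  have hD' : D ≤ A' := h1' ▸ inf_le_left
  constructor
  · rw [inf_sup_left, inf_right_comm, h1, inf_assoc, h1', inf_eq_left.2 hD', inf_eq_right.2 hD,
      sup_idem]
  · rw [sup_inf_right, ← sup_assoc, h2, sup_left_comm, h2', sup_eq_left.2 hB', sup_eq_right.2 hB,
      inf_idem]

open Classical in
/-- Among the complementary pairs of an interval, half come in the order of `L`. -/
theorem two_mul_card_complPairs_filter {D U : X} (hDU : D ≠ U) (L : LinExt X) :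
    2 * ((complPairs D U).filter fun p => L.rel p.1 p.2).card = (complPairs D U).card := by
  have h1 := Finset.card_filter_add_card_filter_not (s := complPairs D U)
    (fun p => L.rel p.1 p.2)
  have h2 : ((complPairs D U).filter fun p => ¬ L.rel p.1 p.2).card =
      ((complPairs D U).filter fun p => L.rel p.1 p.2).card := by
    refine Finset.card_bij (fun p _ => p.swap) ?_ (fun _ _ _ _ h => Prod.swap_injective h) ?_
    · rintro ⟨A, B⟩ h
      rw [Finset.mem_filter] at h ⊢
      exact ⟨swap_mem_complPairs h.1, (L.total A B).resolve_left h.2⟩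
    · rintro ⟨A, B⟩ h
      rw [Finset.mem_filter] at h
      refine ⟨(B, A), ?_, rfl⟩
      rw [Finset.mem_filter]
      refine ⟨swap_mem_complPairs h.1, fun h' => hDU ?_⟩
      obtain rfl : A = B := L.antisymm h.2 h'
      have := mem_complPairs.1 h.1
      rw [inf_idem, sup_idem] at this
      exact this.1.symm.trans this.2
  omega

open Classical in
open scoped FinsetFamily in
/-- By Kleitman's inequality, at most a quarter of the complementary pairs of an interval come in
the order of `L` and against the order of `M`. -/
theorem four_mul_card_complPairs_filter_le {D U : X} (hDU : D ≠ U) (L M : LinExt X) :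
    4 * ((complPairs D U).filter fun p => L.rel p.1 p.2 ∧ M.rel p.2 p.1).card ≤
      (complPairs D U).card := by
  set P := complPairs D U with hP
  set F := P.filter fun p => L.rel p.1 p.2 with hF
  set G := P.filter fun p => M.rel p.1 p.2 with hG
  have hFc : 2 * F.card = P.card := two_mul_card_complPairs_filter hDU L
  have hGc : 2 * G.card = P.card := two_mul_card_complPairs_filter hDU M
  -- With the second coordinate dualized, going down shrinks A and enlarges B. So `F` and `G` are
  -- downsets within `P`: their infima lie in both, and their suprema stay in `P`.
  let φ : X × X → X × Xᵒᵈ := fun p => (p.1, OrderDual.toDual p.2)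
  have hφ : Function.Injective φ := by
    rintro ⟨a, b⟩ ⟨c, d⟩ h
    simpa [φ] using h
  have hkl := Finset.le_card_infs_mul_card_sups (F.image φ) (G.image φ)
  rw [Finset.card_image_of_injective _ hφ, Finset.card_image_of_injective _ hφ] at hkl
  have hinf : (F.image φ ⊼ G.image φ).card ≤ (F ∩ G).card := by
    rw [← Finset.card_image_of_injective _ hφ]
    refine Finset.card_le_card fun q hq => ?_
    rw [Finset.mem_infs] at hq
    obtain ⟨_, ha, _, hb, rfl⟩ := hq
    obtain ⟨⟨A, B⟩, hp, rfl⟩ := Finset.mem_image.1 ha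
    obtain ⟨⟨A', B'⟩, hp', rfl⟩ := Finset.mem_image.1 hb
    rw [hF, Finset.mem_filter] at hp
    rw [hG, Finset.mem_filter] at hp'
    refine Finset.mem_image.2 ⟨(A ⊓ A', B ⊔ B'), ?_, rfl⟩
    have hm := inf_sup_mem_complPairs hp.1 hp'.1
    rw [Finset.mem_inter, hF, hG, Finset.mem_filter, Finset.mem_filter]
    refine ⟨⟨hm, ?_⟩, hm, ?_⟩
    · exact L.trans (L.rel_of_le _ _ inf_le_left) (L.trans hp.2 (L.rel_of_le _ _ le_sup_left))
    · exact M.trans (M.rel_of_le _ _ inf_le_right) (M.trans hp'.2 (M.rel_of_le _ _ le_sup_right))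
  have hsup : (F.image φ ⊻ G.image φ).card ≤ P.card := by
    rw [← Finset.card_image_of_injective _ hφ]
    refine Finset.card_le_card fun q hq => ?_
    rw [Finset.mem_sups] at hq
    obtain ⟨_, ha, _, hb, rfl⟩ := hq
    obtain ⟨⟨A, B⟩, hp, rfl⟩ := Finset.mem_image.1 ha
    obtain ⟨⟨A', B'⟩, hp', rfl⟩ := Finset.mem_image.1 hb
    rw [hF, Finset.mem_filter] at hp
    rw [hG, Finset.mem_filter] at hp'
    refine Finset.mem_image.2 ⟨(A ⊔ A', B ⊓ B'), ?_, rfl⟩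
    exact swap_mem_complPairs
      (inf_sup_mem_complPairs (swap_mem_complPairs hp.1) (swap_mem_complPairs hp'.1))
  have hmul : F.card * G.card ≤ (F ∩ G).card * P.card := hkl.trans (Nat.mul_le_mul hinf hsup)
  have hsd : (P.filter fun p => L.rel p.1 p.2 ∧ M.rel p.2 p.1).card ≤ (F \ G).card := by
    refine Finset.card_le_card ?_
    rintro ⟨A, B⟩ h
    rw [Finset.mem_filter] at h
    rw [Finset.mem_sdiff, hF, hG, Finset.mem_filter, Finset.mem_filter]
    refine ⟨⟨h.1, h.2.1⟩, fun h' => hDU ?_⟩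
    obtain rfl : A = B := M.antisymm h'.2 h.2.2
    have := mem_complPairs.1 h.1
    rw [inf_idem, sup_idem] at this
    exact this.1.symm.trans this.2
  have hcard := Finset.card_sdiff_add_card_inter F G
  rcases Nat.eq_zero_or_pos F.card with h0 | h0
  · omega
  -- As `F` and `G` are both half of `P`, the correlation inequality says that at least half of `F`
  -- lies in `G`. The pairs to be bounded lie in the rest.
  · have : F.card ≤ 2 * (F ∩ G).card := by
      have h1 : F.card * F.card ≤ (2 * (F ∩ G).card) * F.card := by
        have h2 : G.card = F.card := by omega
        rw [h2, ← hFc] at hmul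
        calc _ ≤ _ := hmul
          _ = _ := by ring
      exact Nat.le_of_mul_le_mul_right h1 h0
    omega

end Fibers

/-! ### The colexicographic pair inverts a quarter of every relevant interval -/

namespace IsConjugateOrder

variable {α : Type*} [PartialOrder α] {Q : α → α → Prop}

/-- If m₁ and m₂ both lie in A \ B, cut A \ B at an element z of B \ A. Every element of A \ B is
incomparable to z, hence to its left or right, and elements on different sides are incomparable to
each other. So the left part can be moved from A to B. Extremality puts m₁ on the right of z and m₂
on the left. -/
theorem exists_separated_aux [Fintype (LowerSet α)] [DecidableEq (LowerSet α)] (hQ : IsConjugateOrder Q)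
    {D U A B : LowerSet α} (hAB : (A, B) ∈ complPairs D U) {m₁ m₂ z : α} (h1U : m₁ ∈ U)
    (h1D : m₁ ∉ D) (h1 : ∀ x, conjLT Q m₁ x → ¬ (x ∈ U ∧ x ∉ D)) (h2U : m₂ ∈ U) (h2D : m₂ ∉ D)
    (h2 : ∀ x, conjLT (_root_.flip Q) m₂ x → ¬ (x ∈ U ∧ x ∉ D)) (hA : m₁ ∈ A) (hz : z ∈ B)
    (hzD : z ∉ D) : ∃ A' B', (A', B') ∈ complPairs D U ∧ m₁ ∈ A' ∧ m₂ ∈ B' := by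
  by_cases hB : m₂ ∈ B
  · exact ⟨A, B, hAB, hA, hB⟩
  obtain ⟨rfl, rfl⟩ := mem_complPairs.1 hAB
  simp only [LowerSet.mem_inf_iff, LowerSet.mem_sup_iff] at *
  have h2A : m₂ ∈ A := by tauto
  have inc : ∀ x, x ∈ A → x ∉ B → Q x z ∨ Q z x := by
    intro x hx hxB
    refine hQ.total (fun h => ?_) (fun h => ?_)
    · exact hxB (B.lower h hz)
    · exact hzD ⟨A.lower h hx, hz⟩
  refine ⟨⟨{x | x ∈ A ∧ (x ∈ B ∨ Q z x)}, ?_⟩, ⟨{x | x ∈ B ∨ (x ∈ A ∧ Q x z)}, ?_⟩, ?_, ?_, ?_⟩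
  · rintro x y hyx ⟨hx, hx'⟩
    refine ⟨A.lower hyx hx, ?_⟩
    by_cases hy : y ∈ B
    · exact Or.inl hy
    · rcases hx' with hx' | hx'
      · exact absurd (B.lower hyx hx') hy
      · rcases inc y (A.lower hyx hx) hy with h | h
        · exact absurd hyx (hQ.not_le (hQ.trans h hx'))
        · exact Or.inr h
  · rintro x y hyx (hx | ⟨hx, hx'⟩)
    · exact Or.inl (B.lower hyx hx)
    · by_cases hy : y ∈ B
      · exact Or.inl hy
      · rcases inc y (A.lower hyx hx) hy with h | h
        · exact Or.inr ⟨A.lower hyx hx, h⟩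
        · exact absurd hyx (hQ.not_ge (hQ.trans hx' h))
  · rw [mem_complPairs]
    refine ⟨SetLike.ext fun x => ?_, SetLike.ext fun x => ?_⟩
    · have := @hQ.asymm x z
      change (x ∈ A ∧ (x ∈ B ∨ Q z x)) ∧ (x ∈ B ∨ (x ∈ A ∧ Q x z)) ↔ x ∈ A ∧ x ∈ B
      tauto
    · have := inc x
      change (x ∈ A ∧ (x ∈ B ∨ Q z x)) ∨ (x ∈ B ∨ (x ∈ A ∧ Q x z)) ↔ x ∈ A ∨ x ∈ B
      tauto
  · refine ⟨hA, ?_⟩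
    by_cases h : m₁ ∈ B
    · exact Or.inl h
    · rcases inc m₁ hA h with h' | h'
      · exact absurd ⟨Or.inr hz, fun h => hzD h⟩ (h1 z (Or.inr h'))
      · exact Or.inr h'
  · rcases inc m₂ h2A hB with h' | h'
    · exact Or.inr ⟨h2A, h'⟩
    · exact absurd ⟨Or.inr hz, fun h => hzD h⟩ (h2 z (Or.inr h'))

/-- Cancellation of a symmetric difference, at a single element: the three pairs of propositions
stand for membership in three complementary pairs of the same interval. -/
theorem _root_.iff_of_xor_iff {a b a' b' c d p q : Prop} (h : ((a ∧ b) ↔ p) ∧ ((a ∨ b) ↔ q))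
    (h' : ((a' ∧ b') ↔ p) ∧ ((a' ∨ b') ↔ q)) (h'' : ((c ∧ d) ↔ p) ∧ ((c ∨ d) ↔ q))
    (e : (a ∧ d ∨ b ∧ c) ↔ (a' ∧ d ∨ b' ∧ c)) : a ↔ a' := by
  by_cases c <;> by_cases d <;> simp_all
  tauto

open Classical in
-- The complementary pairs fall into four classes by the sides on which m₁ and m₂ lie. Exchanging
-- the components matches the classes in twos, and the symmetric difference with a fixed separating
-- pair injects a class with m₁ and m₂ on one side into one that separates them.
theorem card_le_four_mul_card_separated [Fintype (LowerSet α)] {D U A' B' : LowerSet α}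
    {m₁ m₂ : α} (h1U : m₁ ∈ U) (h1D : m₁ ∉ D) (h2U : m₂ ∈ U) (h2D : m₂ ∉ D)
    (h' : (A', B') ∈ complPairs D U) (hA' : m₁ ∈ A') (hB' : m₂ ∈ B') :
    (complPairs D U).card ≤ 4 * ((complPairs D U).filter fun p => m₁ ∈ p.2 ∧ m₂ ∈ p.1).card := by
  set P := complPairs D U with hP
  have hpt : ∀ A B, (A, B) ∈ P → ∀ z, ((z ∈ A ∧ z ∈ B) ↔ z ∈ D) ∧ ((z ∈ A ∨ z ∈ B) ↔ z ∈ U) := by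
    intro A B h z
    obtain ⟨rfl, rfl⟩ := mem_complPairs.1 h
    simp
  set T := P.filter fun p => m₁ ∈ p.2 ∧ m₂ ∈ p.1 with hT
  set T₁ := P.filter fun p => m₁ ∈ p.1 ∧ m₂ ∈ p.2 with hT₁
  set T₂ := P.filter fun p => m₁ ∈ p.1 ∧ m₂ ∈ p.1 with hT₂
  set T₃ := P.filter fun p => m₁ ∈ p.2 ∧ m₂ ∈ p.2 with hT₃
  have c1 : T₁.card ≤ T.card := by
    refine Finset.card_le_card_of_injOn Prod.swap ?_ Prod.swap_injective.injOn
    rintro ⟨A, B⟩ h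
    simp only [hT₁, hT, Finset.coe_filter, Set.mem_ofPred_eq] at h ⊢
    exact ⟨swap_mem_complPairs h.1, h.2⟩
  have c2 : T₃.card ≤ T₂.card := by
    refine Finset.card_le_card_of_injOn Prod.swap ?_ Prod.swap_injective.injOn
    rintro ⟨A, B⟩ h
    simp only [hT₃, hT₂, Finset.coe_filter, Set.mem_ofPred_eq] at h ⊢
    exact ⟨swap_mem_complPairs h.1, h.2⟩
  have c3 : T₂.card ≤ T.card := by
    refine Finset.card_le_card_of_injOn
      -- The symmetric difference with (A', B') relative to D and U: the side of m₂ is kept, that of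
      -- m₁ is changed.
      (fun p => ((p.1 ⊓ B') ⊔ (p.2 ⊓ A'), (p.2 ⊔ A') ⊓ (p.1 ⊔ B'))) ?_ ?_
    · rintro ⟨A, B⟩ h
      simp only [hT₂, hT, Finset.coe_filter, Set.mem_ofPred_eq] at h ⊢
      refine ⟨?_, ⟨Or.inr hA', Or.inl h.2.1⟩, Or.inl ⟨h.2.2, hB'⟩⟩
      exact swap_mem_complPairs (inf_sup_mem_complPairs
        (swap_mem_complPairs (inf_sup_mem_complPairs h.1 (swap_mem_complPairs h')))
        (swap_mem_complPairs (inf_sup_mem_complPairs (swap_mem_complPairs h.1) h')))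
    · rintro ⟨A, B⟩ h ⟨A₂, B₂⟩ h₂ heq
      simp only [hT₂, Finset.coe_filter, Set.mem_ofPred_eq] at h h₂
      simp only [Prod.mk.injEq] at heq
      have hA₂ : A = A₂ := by
        refine SetLike.ext fun z => ?_
        have e1 : z ∈ (A ⊓ B') ⊔ (B ⊓ A') ↔ z ∈ (A₂ ⊓ B') ⊔ (B₂ ⊓ A') := by rw [heq.1]
        have h1 := hpt _ _ h.1 z
        have h2 := hpt _ _ h' z
        have h3 := hpt _ _ h₂.1 z
        simp only [LowerSet.mem_inf_iff, LowerSet.mem_sup_iff] at e1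
        exact iff_of_xor_iff h1 h3 h2 e1
      subst hA₂
      refine Prod.ext rfl (SetLike.ext fun z => ?_)
      have h1 := hpt _ _ h.1 z
      have h3 := hpt _ _ h₂.1 z
      change z ∈ B ↔ z ∈ B₂
      tauto
  have hcover : P ⊆ (T ∪ T₁) ∪ (T₂ ∪ T₃) := by
    rintro ⟨A, B⟩ h
    have e1 : m₁ ∈ A ∨ m₁ ∈ B := ((hpt _ _ h m₁).2).2 h1U
    have e2 : m₂ ∈ A ∨ m₂ ∈ B := ((hpt _ _ h m₂).2).2 h2U
    simp only [Finset.mem_union, hT, hT₁, hT₂, hT₃, Finset.mem_filter]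
    rcases e1 with e1 | e1 <;> rcases e2 with e2 | e2
    · exact Or.inr (Or.inl ⟨h, e1, e2⟩)
    · exact Or.inl (Or.inr ⟨h, e1, e2⟩)
    · exact Or.inl (Or.inl ⟨h, e1, e2⟩)
    · exact Or.inr (Or.inr ⟨h, e1, e2⟩)
  have := Finset.card_le_card hcover
  have u1 := Finset.card_union_le (T ∪ T₁) (T₂ ∪ T₃)
  have u2 := Finset.card_union_le T T₁
  have u3 := Finset.card_union_le T₂ T₃
  omega

open Classical in
-- A single inversion of `L` and `M` in the interval yields incomparable downsets, hence a pair
-- separating the two last elements of U \ D. Then at most a quarter on the left faces at least a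
-- quarter on the right.
theorem card_inversions_fiber_le [Finite α] [Fintype (LowerSet α)] (hQ : IsConjugateOrder Q)
    (D U : LowerSet α) (L M : LinExt (LowerSet α)) :
    ((complPairs D U).filter fun p => p.1 ≠ p.2 ∧ L.rel p.1 p.2 ∧ M.rel p.2 p.1).card ≤
      ((complPairs D U).filter fun p => p.1 ≠ p.2 ∧
        hQ.colex.rel p.1 p.2 ∧ hQ.flip.colex.rel p.2 p.1).card := by
  rcases Finset.eq_empty_or_nonempty
    ((complPairs D U).filter fun p => p.1 ≠ p.2 ∧ L.rel p.1 p.2 ∧ M.rel p.2 p.1) with h0 | h0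
  · simp [h0]
  obtain ⟨⟨A, B⟩, h⟩ := h0
  obtain ⟨hAB, hne, hL, hM⟩ := Finset.mem_filter.1 h
  simp only at hne hL hM
  have hnle : ¬ A ≤ B := fun h => hne (M.antisymm (M.rel_of_le _ _ h) hM)
  have hnge : ¬ B ≤ A := fun h => hne (L.antisymm hL (L.rel_of_le _ _ h))
  obtain ⟨a, haA, haB⟩ := Set.not_subset.1 hnle
  obtain ⟨b, hbB, hbA⟩ := Set.not_subset.1 hnge
  rw [SetLike.mem_coe] at haA haB hbB hbA
  obtain ⟨hD, hU⟩ := mem_complPairs.1 hAB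
  have hne' : {x | x ∈ U ∧ x ∉ D}.Nonempty := ⟨a, by
    rw [← hD, ← hU]
    simp [haA, haB]⟩
  have hDU : D ≠ U := by
    rintro rfl
    obtain ⟨x, hx⟩ := hne'
    exact hx.2 hx.1
  obtain ⟨m₁, ⟨h1U, h1D⟩, h1⟩ := hQ.exists_max hne'
  obtain ⟨m₂, ⟨h2U, h2D⟩, h2⟩ := hQ.flip.exists_max hne'
  obtain ⟨A', B', hAB', hA', hB'⟩ :
      ∃ A' B', (A', B') ∈ complPairs D U ∧ m₁ ∈ A' ∧ m₂ ∈ B' := by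
    have : m₁ ∈ A ∨ m₁ ∈ B := by
      rw [← hU] at h1U
      simpa using h1U
    rcases this with hm | hm
    · refine hQ.exists_separated_aux hAB h1U h1D h1 h2U h2D h2 hm hbB ?_
      rw [← hD]
      simp [hbA]
    · refine hQ.exists_separated_aux (swap_mem_complPairs hAB) h1U h1D h1 h2U h2D h2 hm haA ?_
      rw [← hD]
      simp [haB]
  have k1 := four_mul_card_complPairs_filter_le hDU L M
  have k2 := card_le_four_mul_card_separated h1U h1D h2U h2D hAB' hA' hB'
  have k3 : ((complPairs D U).filter fun p => p.1 ≠ p.2 ∧ L.rel p.1 p.2 ∧ M.rel p.2 p.1).card ≤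
      ((complPairs D U).filter fun p => L.rel p.1 p.2 ∧ M.rel p.2 p.1).card :=
    Finset.card_le_card (Finset.monotone_filter_right _ fun p _ hp => hp.2)
  -- The two components differ exactly on U \ D, whose last elements in the two linear orders are m₁
  -- and m₂. So the sides of m₁ and m₂ decide both comparisons.
  have k4 : ((complPairs D U).filter fun p => m₁ ∈ p.2 ∧ m₂ ∈ p.1).card ≤
      ((complPairs D U).filter fun p => p.1 ≠ p.2 ∧
        hQ.colex.rel p.1 p.2 ∧ hQ.flip.colex.rel p.2 p.1).card := by
    refine Finset.card_le_card ?_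
    rintro ⟨S, T⟩ h
    rw [Finset.mem_filter] at h ⊢
    refine ⟨h.1, (hQ.mem_inversions_colex (A := S) (B := T)).2 ?_⟩
    obtain ⟨rfl, rfl⟩ := mem_complPairs.1 h.1
    have h1m := h.2.1
    have h2m := h.2.2
    simp only [LowerSet.mem_inf_iff, LowerSet.mem_sup_iff, Set.mem_ofPred_eq] at *
    refine ⟨⟨m₁, h1m, by tauto, fun z hz => ?_⟩, ⟨m₂, h2m, by tauto, fun z hz => ?_⟩⟩
    · have := h1 z hz
      tauto
    · have := h2 z hz
      tauto
  omega

theorem ncard_inversions_le [Finite α] (hQ : IsConjugateOrder Q) (L M : LinExt (LowerSet α)) :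
    (LinExt.inversions L M).ncard ≤ (LinExt.inversions hQ.colex hQ.flip.colex).ncard := by
  classical
  have := Fintype.ofFinite (LowerSet α)
  have key : ∀ L M : LinExt (LowerSet α), (LinExt.inversions L M).ncard =
      ∑ q : LowerSet α × LowerSet α, ((complPairs q.1 q.2).filter fun p =>
        p.1 ≠ p.2 ∧ L.rel p.1 p.2 ∧ M.rel p.2 p.1).card := by
    intro L M
    have h1 : LinExt.inversions L M = ((Finset.univ.filter fun p : LowerSet α × LowerSet α =>
        p.1 ≠ p.2 ∧ L.rel p.1 p.2 ∧ M.rel p.2 p.1 : Finset _) : Set (LowerSet α × LowerSet α)) := by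
      ext p
      simp [LinExt.inversions]
    -- Every pair belongs to exactly one interval, the one from its meet to its join.
    rw [h1, Set.ncard_coe_finset, Finset.card_eq_sum_card_fiberwise
      (f := fun p : LowerSet α × LowerSet α => (p.1 ⊓ p.2, p.1 ⊔ p.2)) (t := Finset.univ)
      (fun _ _ => Finset.mem_coe.2 (Finset.mem_univ _))]
    refine Finset.sum_congr rfl fun q _ => congrArg Finset.card ?_
    ext p
    simp only [Finset.mem_filter, Finset.mem_univ, true_and, complPairs, Prod.ext_iff]
    tauto
  rw [key, key]
  exact Finset.sum_le_sum fun q _ => hQ.card_inversions_fiber_le q.1 q.2 L M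

/-- The colexicographic orders of a conjugate order and its reverse form a diametral pair. -/
theorem led_lowerSet_eq [Finite α] (hQ : IsConjugateOrder Q) :
    led (LowerSet α) = (LinExt.inversions hQ.colex hQ.flip.colex).ncard :=
  LinExt.led_eq_of_isMax _ _ fun L M => hQ.ncard_inversions_le L M

end IsConjugateOrder

/-- A realizer of size at most two yields a conjugate order. -/
theorem IsTwoDimensional.exists_isConjugateOrder {α : Type*} [PartialOrder α] (h : IsTwoDimensional α) :
    ∃ Q : α → α → Prop, IsConjugateOrder Q := by
  obtain ⟨L₁, L₂, h⟩ := h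
  have h' : ∀ x y : α, x ≤ y ↔ L₁.rel x y ∧ L₂.rel x y := by
    intro x y
    rw [h x y]
    simp
  refine ⟨fun x y => x ≠ y ∧ L₁.rel x y ∧ L₂.rel y x, ?_, ?_, ?_, ?_, ?_⟩
  · rintro x y ⟨hne, h1, h2⟩ hle
    exact hne (L₂.antisymm ((h' _ _).1 hle).2 h2)
  · rintro x y ⟨hne, h1, h2⟩ hle
    exact hne (L₁.antisymm h1 ((h' _ _).1 hle).1)
  · intro x y h1 h2
    have hne : x ≠ y := fun h => h1 h.le
    rw [h'] at h1 h2
    have t1 := L₁.total x y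
    have t2 := L₂.total x y
    have := hne.symm
    tauto
  · rintro x y ⟨hne, h1, h2⟩ ⟨-, h1', h2'⟩
    exact hne (L₁.antisymm h1 h1')
  · rintro x y z ⟨hne, h1, h2⟩ ⟨hne', h1', h2'⟩
    refine ⟨?_, L₁.trans h1 h1', L₂.trans h2' h2⟩
    rintro rfl
    exact hne (L₁.antisymm h1 h1')

/-! ### Counting the inversions of the colexicographic pair -/

/-- The downsets of the subposet induced on `W`. -/
def relDownsets {α : Type*} [PartialOrder α] (W : Set α) : Set (Set α) :=
  {I | I ⊆ W ∧ ∀ y ∈ I, ∀ y' ∈ W, y' ≤ y → y' ∈ I}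

/-- The elements to the right of `x` that are not above `m`. -/
def rightAvoiding {α : Type*} [PartialOrder α] (Q : α → α → Prop) (x m : α) : Set α :=
  {z | Q x z ∧ ¬ m ≤ z}

/-- The number of downsets of the subposet of the elements to the right of `x` that are not
above `m`. -/
noncomputable def downsetCount {α : Type*} [PartialOrder α] (Q : α → α → Prop) (x m : α) : ℕ :=
  Nat.card (relDownsets (rightAvoiding Q x m))

namespace IsConjugateOrder

variable {α : Type*} [PartialOrder α] {Q : α → α → Prop}

theorem trichotomy (hQ : IsConjugateOrder Q) (x y : α) :
    x ≤ y ∨ x > y ∨ Q x y ∨ Q y x := by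
  rcases hQ.lt_trichotomy x y with (h | h) | rfl | h | h
  · exact Or.inl h.le
  · exact Or.inr (Or.inr (Or.inl h))
  · exact Or.inl le_rfl
  · exact Or.inr (Or.inl h)
  · exact Or.inr (Or.inr (Or.inr h))

/-- The downset of `rightAvoiding Q x m` with leftmost maximal element `z` and the part `J` to the
right of `z`. -/
theorem insert_mem_relDownsets (hQ : IsConjugateOrder Q) {x m z : α}
    {J : Set α} (hJ : J ∈ relDownsets (rightAvoiding Q z m)) :
    {y | y ∈ rightAvoiding Q x m ∧ (y ≤ z ∨ y ∈ J)} ∈ relDownsets (rightAvoiding Q x m) := by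
  refine ⟨fun y hy => hy.1, ?_⟩
  rintro y ⟨-, hy | hy⟩ y' hy'W hle
  · exact ⟨hy'W, Or.inl (hle.trans hy)⟩
  · refine ⟨hy'W, ?_⟩
    have hzy := hJ.1 hy
    rcases hQ.trichotomy y' z with h | h | h | h
    · exact Or.inl h
    · exact absurd (h.le.trans hle) (hQ.not_le hzy.1)
    · exact absurd hle (hQ.not_le (hQ.trans h hzy.1))
    · exact Or.inr (hJ.2 y hy y' ⟨h, hy'W.2⟩ hle)

/-- A nonempty downset has a leftmost maximal element z, and all its elements are below z or to the
right of z. The part below z is determined by z; the part to the right is an arbitrary downset of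
the same kind with z in place of x. The summand 1 is the empty set. -/
theorem downsetCount_eq [Fintype α] (hQ : IsConjugateOrder Q) (x m : α)
    [DecidablePred (· ∈ rightAvoiding Q x m)] :
    downsetCount Q x m = 1 + ∑ z, if z ∈ rightAvoiding Q x m then downsetCount Q z m else 0 := by
  let φ : Option (Σ z : rightAvoiding Q x m, relDownsets (rightAvoiding Q z.1 m)) →
      relDownsets (rightAvoiding Q x m) := fun o => match o with
    | none => ⟨∅, by simp, by simp⟩
    | some ⟨z, J⟩ => ⟨_, hQ.insert_mem_relDownsets (x := x) J.2⟩
  have hφz : ∀ z J, z.1 ∈ (φ (some ⟨z, J⟩)).1 := fun z J => ⟨z.2, Or.inl le_rfl⟩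
  have hφJ : ∀ (z : rightAvoiding Q x m) (J : relDownsets (rightAvoiding Q z.1 m)), (J : Set α) = (φ (some ⟨z, J⟩)).1 ∩ {y | Q z.1 y} := by
    intro z J
    ext y
    constructor
    · intro hy
      have := J.2.1 hy
      exact ⟨⟨⟨hQ.trans z.2.1 this.1, this.2⟩, Or.inr hy⟩, this.1⟩
    · rintro ⟨⟨-, h | h⟩, h'⟩
      · exact absurd h (hQ.not_ge h')
      · exact h
  have hφmax : ∀ z J, ∀ y ∈ (φ (some ⟨z, J⟩)).1, y ≤ z.1 ∨ Q z.1 y := by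
    rintro z J y ⟨-, h | h⟩
    · exact Or.inl h
    · exact Or.inr (J.2.1 h).1
  have hbij : Function.Bijective φ := by
    constructor
    · rintro (_ | ⟨z, J⟩) (_ | ⟨z', J'⟩) h
      · rfl
      · have := hφz z' J'
        rw [← h] at this
        exact absurd this (Set.notMem_empty _)
      · have := hφz z J
        rw [h] at this
        exact absurd this (Set.notMem_empty _)
      · have h1 := hφmax z' J' z (h ▸ hφz z J)
        have h2 := hφmax z J z' (h.symm ▸ hφz z' J')
        have hzz : z = z' := by
          apply Subtype.ext
          rcases h1 with h1 | h1 <;> rcases h2 with h2 | h2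
          · exact le_antisymm h1 h2
          · exact absurd h1 (hQ.not_le h2)
          · exact absurd h2 (hQ.not_le h1)
          · exact absurd h1 (hQ.asymm h2)
        subst hzz
        have hJJ : J = J' := Subtype.ext (by rw [hφJ z J, hφJ z J', h])
        rw [hJJ]
    · rintro ⟨I, hI⟩
      rcases I.eq_empty_or_nonempty with rfl | hne
      · exact ⟨none, rfl⟩
      obtain ⟨z, hz, hmax⟩ := hQ.flip.exists_max hne
      have hmax' : ∀ y ∈ I, y ≤ z ∨ Q z y := by
        intro y hy
        rcases hQ.trichotomy y z with h | h | h | h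
        · exact Or.inl h
        · exact absurd hy (hmax y (Or.inl h))
        · exact absurd hy (hmax y (Or.inr h))
        · exact Or.inr h
      refine ⟨some ⟨⟨z, hI.1 hz⟩, ⟨I ∩ {y | Q z y}, ?_, ?_⟩⟩, Subtype.ext ?_⟩
      · rintro y ⟨hy, hzy⟩
        exact ⟨hzy, (hI.1 hy).2⟩
      · rintro y ⟨hy, -⟩ y' ⟨h1, h2⟩ hle
        exact ⟨hI.2 y hy y' ⟨hQ.trans (hI.1 hz).1 h1, h2⟩ hle, h1⟩
      · ext y
        constructor
        · rintro ⟨hW, hy | hy⟩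
          · exact hI.2 z hz y hW hy
          · exact hy.1
        · intro hy
          exact ⟨hI.1 hy, (hmax' y hy).imp id fun h => ⟨hy, h⟩⟩
  rw [downsetCount, ← Nat.card_congr (Equiv.ofBijective φ hbij), Finite.card_option,
    Nat.card_sigma, add_comm, ← Finset.sum_filter]
  congr 1
  symm
  apply Finset.sum_subtype
  simp

/-- The downset that is recovered from its free parts `I` and `J`. -/
def glue (Q : α → α → Prop) (m : α) (I J : Set α) : Set α :=
  {z | z ≤ m ∨ z ∈ I ∨ (z ∈ J ∧ Q z m)}

/-! ### Inversions from their two last elements and two free parts -/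

section Glue

variable {m₁ m₂ : α} {I J : Set α}

/-- Below an element to the right of m₂ there are only elements below m₂ or to its right, and
likewise on the left. So the three parts never obstruct each other. -/
theorem isLowerSet_glue (hQ : IsConjugateOrder Q)
    (hI : I ∈ relDownsets (rightAvoiding Q m₂ m₁))
    (hJ : J ∈ relDownsets (rightAvoiding (_root_.flip Q) m₁ m₂)) (hm : Q m₂ m₁) :
    IsLowerSet (glue Q m₂ I J) := by
  rintro y y' hle (hy | hy | ⟨hy, hy'⟩)
  · exact Or.inl (hle.trans hy)
  · have h := hI.1 hy
    rcases hQ.trichotomy y' m₂ with h' | h' | h' | h'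
    · exact Or.inl h'
    · exact absurd (h'.le.trans hle) (hQ.not_le h.1)
    · exact absurd hle (hQ.not_le (hQ.trans h' h.1))
    · exact Or.inr (Or.inl (hI.2 y hy y' ⟨h', fun h'' => h.2 (h''.trans hle)⟩ hle))
  · rcases hQ.trichotomy y' m₂ with h' | h' | h' | h'
    · exact Or.inl h'
    · exact absurd (h'.le.trans hle) (hQ.not_ge hy')
    · exact Or.inr (Or.inr ⟨hJ.2 y hy y' ⟨hQ.trans h' hm, hQ.not_ge h'⟩ hle, h'⟩)
    · exact absurd hle (hQ.not_ge (hQ.trans hy' h'))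

theorem notMem_glue (hQ : IsConjugateOrder Q) (hI : I ∈ relDownsets (rightAvoiding Q m₂ m₁))
    (hm : Q m₂ m₁) : m₁ ∉ glue Q m₂ I J := by
  rintro (h | h | ⟨-, h⟩)
  · exact hQ.not_ge hm h
  · exact (hI.1 h).2 le_rfl
  · exact hQ.asymm hm h

/-- Elements above m₁ lie in neither downset; for elements to the right of m₁ membership in either
is membership in I. -/
theorem mem_glue_iff (hQ : IsConjugateOrder Q) (hI : I ∈ relDownsets (rightAvoiding Q m₂ m₁))
    (hJ : J ∈ relDownsets (rightAvoiding (_root_.flip Q) m₁ m₂)) (hm : Q m₂ m₁) {z : α}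
    (hz : conjLT Q m₁ z) : z ∈ glue Q m₂ I J ↔ z ∈ glue (_root_.flip Q) m₁ J I := by
  rcases hz with hz | hz
  · constructor
    · rintro (h | h | ⟨-, h⟩)
      · exact absurd (hz.le.trans h) (hQ.not_ge hm)
      · exact absurd hz.le (hI.1 h).2
      · exact absurd hz.le (hQ.not_ge (hQ.trans h hm))
    · rintro (h | h | ⟨-, h⟩)
      · exact absurd hz h.not_gt
      · exact absurd hz.le (hQ.not_ge (hJ.1 h).1)
      · exact absurd hz.le (hQ.not_le h)
  · constructor
    · rintro (h | h | ⟨-, h⟩)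
      · exact absurd h (hQ.not_ge (hQ.trans hm hz))
      · exact Or.inr (Or.inr ⟨h, hz⟩)
      · exact absurd (hQ.trans h hm) (hQ.asymm hz)
    · rintro (h | h | ⟨h, -⟩)
      · exact absurd h (hQ.not_ge hz)
      · exact absurd (hJ.1 h).1 (hQ.asymm hz)
      · exact Or.inr (Or.inl h)

theorem colexRel_glue (hQ : IsConjugateOrder Q)
    (hI : I ∈ relDownsets (rightAvoiding Q m₂ m₁))
    (hJ : J ∈ relDownsets (rightAvoiding (_root_.flip Q) m₁ m₂)) (hm : Q m₂ m₁) :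
    colexRel Q ⟨_, hQ.isLowerSet_glue hI hJ hm⟩ ⟨_, hQ.flip.isLowerSet_glue hJ hI hm⟩ :=
  ⟨m₁, Or.inl le_rfl, hQ.notMem_glue hI hm, fun _ hz => hQ.mem_glue_iff hI hJ hm hz⟩

theorem glue_inter (hQ : IsConjugateOrder Q) (hI : I ∈ relDownsets (rightAvoiding Q m₂ m₁)) :
    glue Q m₂ I J ∩ rightAvoiding Q m₂ m₁ = I := by
  ext z
  constructor
  · rintro ⟨h | h | ⟨-, h⟩, h1, -⟩
    · exact absurd h (hQ.not_ge h1)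
    · exact h
    · exact absurd h (hQ.asymm h1)
  · exact fun h => ⟨Or.inr (Or.inl h), hI.1 h⟩

theorem inter_mem_relDownsets (A : LowerSet α) (W : Set α) : (A : Set α) ∩ W ∈ relDownsets W :=
  ⟨Set.inter_subset_right, fun _ hy _ hy' hle => ⟨A.lower hle hy.1, hy'⟩⟩

/-- To the left of m₂ the downsets agree, so there A can be read off from B; below m₂ it contains
everything and above m₂ nothing. -/
theorem eq_glue (hQ : IsConjugateOrder Q) {A B : LowerSet α} (h1 : m₁ ∉ A) (h2 : m₂ ∈ A)
    (h2' : m₂ ∉ B) (hm : Q m₂ m₁) (hmax : ∀ z, conjLT (_root_.flip Q) m₂ z → (z ∈ B ↔ z ∈ A)) :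
    (A : Set α) = glue Q m₂ (A ∩ rightAvoiding Q m₂ m₁)
      (B ∩ rightAvoiding (_root_.flip Q) m₁ m₂) := by
  ext z
  constructor
  · intro hz
    rcases hQ.trichotomy z m₂ with h | h | h | h
    · exact Or.inl h
    · exact absurd (B.lower h.le ((hmax z (Or.inl h)).2 hz)) h2'
    · exact Or.inr (Or.inr ⟨⟨(hmax z (Or.inr h)).2 hz, hQ.trans h hm, hQ.not_ge h⟩, h⟩)
    · exact Or.inr (Or.inl ⟨hz, h, fun h' => h1 (A.lower h' hz)⟩)
  · rintro (h | h | ⟨h, h'⟩)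
    · exact A.lower h h2
    · exact h.1
    · exact (hmax z (Or.inr h')).1 h.1

end Glue

theorem colexRel_witness_unique (hQ : IsConjugateOrder Q) {A B : LowerSet α} {m m' : α}
    (h1 : m ∈ B) (h2 : m ∉ A) (h3 : ∀ z, conjLT Q m z → (z ∈ A ↔ z ∈ B)) (h1' : m' ∈ B)
    (h2' : m' ∉ A) (h3' : ∀ z, conjLT Q m' z → (z ∈ A ↔ z ∈ B)) : m = m' := by
  rcases hQ.lt_trichotomy m m' with h | h | h
  · exact absurd ((h3 _ h).2 h1') h2'
  · exact h
  · exact absurd ((h3' _ h).2 h1) h2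

/-- The number of inversions of the colexicographic pair. -/
theorem ncard_inversions_colex [Fintype α] (hQ : IsConjugateOrder Q) [DecidableRel Q] :
    (LinExt.inversions hQ.colex hQ.flip.colex).ncard =
      ∑ x, ∑ y, if Q x y then downsetCount Q x y * downsetCount (_root_.flip Q) y x else 0 := by
  -- The index pair is (m₂, m₁). Injectivity recovers m₁ and m₂ as the last differing elements in
  -- the two linear orders, and then the free parts as traces of the two downsets.
  let φ : (Σ p : {p : α × α // Q p.1 p.2}, relDownsets (rightAvoiding Q p.1.1 p.1.2) ×
      relDownsets (rightAvoiding (_root_.flip Q) p.1.2 p.1.1)) →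
      LinExt.inversions hQ.colex hQ.flip.colex := fun q =>
    ⟨(⟨_, hQ.isLowerSet_glue q.2.1.2 q.2.2.2 q.1.2⟩,
      ⟨_, hQ.flip.isLowerSet_glue q.2.2.2 q.2.1.2 q.1.2⟩),
      hQ.mem_inversions_colex.2 ⟨hQ.colexRel_glue q.2.1.2 q.2.2.2 q.1.2,
        hQ.flip.colexRel_glue q.2.2.2 q.2.1.2 q.1.2⟩⟩
  have hbij : Function.Bijective φ := by
    constructor
    · rintro ⟨⟨⟨m₂, m₁⟩, hm⟩, ⟨I, hI⟩, ⟨J, hJ⟩⟩ ⟨⟨⟨m₂', m₁'⟩, hm'⟩, ⟨I', hI'⟩, ⟨J', hJ'⟩⟩ h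
      simp only at hI hJ hI' hJ' hm hm'
      have hA : glue Q m₂ I J = glue Q m₂' I' J' :=
        congrArg (fun p => (p.1.1 : Set α)) h
      have hB : glue (_root_.flip Q) m₁ J I = glue (_root_.flip Q) m₁' J' I' :=
        congrArg (fun p => (p.1.2 : Set α)) h
      have e1 : m₁ = m₁' := by
        refine hQ.colexRel_witness_unique (A := ⟨_, hQ.isLowerSet_glue hI hJ hm⟩)
          (B := ⟨_, hQ.flip.isLowerSet_glue hJ hI hm⟩) (Or.inl le_rfl) (hQ.notMem_glue hI hm)
          (fun _ hz => hQ.mem_glue_iff hI hJ hm hz) ?_ ?_ ?_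
        · change m₁' ∈ glue (_root_.flip Q) m₁ J I
          rw [hB]
          exact Or.inl le_rfl
        · change m₁' ∉ glue Q m₂ I J
          rw [hA]
          exact hQ.notMem_glue hI' hm'
        · intro z hz
          change z ∈ glue Q m₂ I J ↔ z ∈ glue (_root_.flip Q) m₁ J I
          rw [hA, hB]
          exact hQ.mem_glue_iff hI' hJ' hm' hz
      have e2 : m₂ = m₂' := by
        refine hQ.flip.colexRel_witness_unique (A := ⟨_, hQ.flip.isLowerSet_glue hJ hI hm⟩)
          (B := ⟨_, hQ.isLowerSet_glue hI hJ hm⟩) (Or.inl le_rfl) (hQ.flip.notMem_glue hJ hm)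
          (fun _ hz => hQ.flip.mem_glue_iff hJ hI hm hz) ?_ ?_ ?_
        · change m₂' ∈ glue Q m₂ I J
          rw [hA]
          exact Or.inl le_rfl
        · change m₂' ∉ glue (_root_.flip Q) m₁ J I
          rw [hB]
          exact hQ.flip.notMem_glue hJ' hm'
        · intro z hz
          change z ∈ glue (_root_.flip Q) m₁ J I ↔ z ∈ glue Q m₂ I J
          rw [hA, hB]
          exact hQ.flip.mem_glue_iff hJ' hI' hm' hz
      subst e1 e2
      have eI : I = I' := by
        rw [← hQ.glue_inter (J := J) hI, ← hQ.glue_inter (J := J') hI', hA]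
      have eJ : J = J' := by
        rw [← hQ.flip.glue_inter (J := I) hJ, ← hQ.flip.glue_inter (J := I') hJ', hB]
      subst eI eJ
      rfl
    · rintro ⟨⟨A, B⟩, h⟩
      obtain ⟨⟨m₁, h1, h2, h3⟩, ⟨m₂, h1', h2', h3'⟩⟩ := hQ.mem_inversions_colex.1 h
      -- Comparability would put m₁ into A or m₂ into B. If m₂ were to the right of m₁, the downsets
      -- would agree at m₂.
      have hm : Q m₂ m₁ := by
        rcases hQ.trichotomy m₂ m₁ with h | h | h | h
        · exact absurd (B.lower h h1) h2'
        · exact absurd (A.lower h.le h1') h2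
        · exact h
        · exact absurd ((h3 _ (Or.inr h)).1 h1') h2'
      refine ⟨⟨⟨(m₂, m₁), hm⟩, ⟨_, inter_mem_relDownsets A _⟩, ⟨_, inter_mem_relDownsets B _⟩⟩,
        Subtype.ext (Prod.ext (SetLike.coe_injective ?_) (SetLike.coe_injective ?_))⟩
      · exact (hQ.eq_glue h2 h1' h2' hm h3').symm
      · exact (hQ.flip.eq_glue h2' h1 h2 hm h3).symm
  rw [← Nat.card_coe_set_eq, ← Nat.card_congr (Equiv.ofBijective φ hbij), Nat.card_sigma,
    ← Fintype.sum_prod_type', ← Finset.sum_filter]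
  symm
  simp_rw [Nat.card_prod]
  exact Finset.sum_subtype _ (by simp)
    (fun p : α × α => downsetCount Q p.1 p.2 * downsetCount (_root_.flip Q) p.2 p.1)

theorem downsetCount_le [Fintype α] (Q : α → α → Prop) (x m : α) :
    downsetCount Q x m ≤ 2 ^ Fintype.card α := by
  rw [downsetCount, Nat.card_coe_set_eq]
  calc _ ≤ (Set.univ : Set (Set α)).ncard := Set.ncard_le_ncard (Set.subset_univ _)
    _ = _ := by simp [Set.ncard_univ]

end IsConjugateOrder

/-! ### Transitive orientations -/

section Orientation

variable {α : Type*}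

/-- In a transitive orientation of the graph `E`, the orientation of the edge `p` directly forces
the orientation of the edge `q`. -/
inductive Forces (E : α → α → Prop) : α × α → α × α → Prop
  | left {a b b' : α} (h : E a b) (h' : E a b') (hb : ¬ E b b') : Forces E (a, b) (a, b')
  | right {a a' b : α} (h : E a b) (h' : E a' b) (ha : ¬ E a a') : Forces E (a, b) (a', b)

/-- The oriented edges `p` and `q` are in the same implication class. -/
abbrev SameClass (E : α → α → Prop) : α × α → α × α → Prop := Relation.ReflTransGen (Forces E)

variable {E : α → α → Prop}

theorem Forces.symm (hE : ∀ x y, E x y → E y x) {p q : α × α} (h : Forces E p q) :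
    Forces E q p := by
  cases h with
  | left h h' hb => exact .left h' h fun h => hb (hE _ _ h)
  | right h h' hb => exact .right h' h fun h => hb (hE _ _ h)

theorem Forces.swap (hE : ∀ x y, E x y → E y x) {p q : α × α} (h : Forces E p q) :
    Forces E p.swap q.swap := by
  cases h with
  | left h h' hb => exact .right (hE _ _ h) (hE _ _ h') hb
  | right h h' hb => exact .left (hE _ _ h) (hE _ _ h') hb

theorem SameClass.symm (hE : ∀ x y, E x y → E y x) {p q : α × α} (h : SameClass E p q) :
    SameClass E q p := by
  induction h with
  | refl => exact .refl
  | tail _ h ih => exact .head (h.symm hE) ih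

theorem SameClass.swap (hE : ∀ x y, E x y → E y x) {a b c d : α}
    (h : SameClass E (a, b) (c, d)) : SameClass E (b, a) (d, c) :=
  Relation.ReflTransGen.lift Prod.swap (fun _ _ h' => Forces.swap hE h') _ _ h

theorem SameClass.edge {a b c d : α} (h : SameClass E (a, b) (c, d)) (hab : E a b) : E c d := by
  rcases Relation.ReflTransGen.cases_tail h with h | ⟨_, _, h⟩
  · cases h
    exact hab
  · cases h with
    | left _ h _ => exact h
    | right _ h _ => exact h

/-- The triangle lemma for implication classes. -/
theorem SameClass.triangle (hE : ∀ x y, E x y → E y x) {a b c : α} (hab : E a b) (hac : E a c)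
    (h₁ : ¬ SameClass E (b, c) (a, c)) (h₂ : ¬ SameClass E (b, c) (b, a)) {q : α × α}
    (h : SameClass E (b, c) q) :
    SameClass E (a, b) (a, q.1) ∧ SameClass E (a, c) (a, q.2) := by
  induction h with
  | refl => exact ⟨.refl, .refl⟩
  | tail h hs ih =>
    have hbc := h.tail hs
    obtain ⟨ih1, ih2⟩ := ih
    cases hs with
    | @left b' c' c'' e1 e2 hn =>
      refine ⟨ih1, ?_⟩
      by_cases hac'' : E a c''
      · exact ih2.tail (.left (ih2.edge hac) hac'' hn)
      · refine absurd ?_ h₂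
        refine (hbc.tail (.left e2 (hE _ _ (ih1.edge hab)) fun h => hac'' (hE _ _ h))).trans ?_
        exact (ih1.symm hE).swap hE
    | @right b' b'' c' e1 e2 hn =>
      refine ⟨?_, ih2⟩
      by_cases hab'' : E a b''
      · exact ih1.tail (.left (ih1.edge hab) hab'' hn)
      · refine absurd ?_ h₁
        refine (hbc.tail (.right e2 (ih2.edge hac) fun h => hab'' (hE _ _ h))).trans ?_
        exact ih2.symm hE

/-- A set of oriented edges that is closed under forcing and transitivity. -/
structure IsClosedOrientation (E T : α → α → Prop) : Prop where
  edge : ∀ {x y}, T x y → E x y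
  asymm : ∀ {x y}, T x y → ¬ T y x
  trans : ∀ {x y z}, T x y → T y z → T x z
  forces : ∀ {x y u v}, T x y → Forces E (x, y) (u, v) → T u v

theorem IsClosedOrientation.sameClass {T : α → α → Prop} (hT : IsClosedOrientation E T)
    {p q : α × α} (h : T p.1 p.2) (h' : SameClass E p q) : T q.1 q.2 := by
  induction h' with
  | refl => exact h
  | tail _ hs ih => exact hT.forces ih hs

/-- The existence of a closed orientation containing the edge in some direction rules out that its
implication class contains an edge in both directions. -/
theorem IsClosedOrientation.sameClass_asymm (hE : ∀ x y, E x y → E y x) {F : α → α → Prop}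
    (hF : IsClosedOrientation E F) {a b : α} (hab : F a b ∨ F b a) (x y : α)
    (h : SameClass E (a, b) (x, y)) : ¬ SameClass E (a, b) (y, x) := by
  intro h'
  rcases hab with h0 | h0
  · exact hF.asymm (hF.sameClass h0 h) (hF.sameClass h0 h')
  · exact hF.asymm (hF.sameClass (p := (b, a)) (q := (y, x)) h0 (h.swap hE))
      (hF.sameClass (p := (b, a)) (q := (x, y)) h0 (h'.swap hE))

/-- If (x, z) were an edge outside the class, the triangle lemma with apex x, applied to (x, y) as a
member of the class of (y, z), would put (x, x) into the class of (x, y). If it were not an edge,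
(x, y) would force (z, y). -/
theorem SameClass.trans_of_asymm (hE : ∀ x y, E x y → E y x) (hirr : ∀ x, ¬ E x x) {p : α × α}
    (hp : E p.1 p.2) (hA : ∀ x y, SameClass E p (x, y) → ¬ SameClass E p (y, x)) {x y z : α}
    (hxy : SameClass E p (x, y)) (hyz : SameClass E p (y, z)) : SameClass E p (x, z) := by
  have exy : E x y := hxy.edge hp
  have eyz : E y z := hyz.edge hp
  by_contra hcon
  have exz : E x z := by
    by_contra h
    exact hA _ _ hyz (hxy.tail (.right exy (hE _ _ eyz) h))
  have h := SameClass.triangle hE exy exz (fun h => hcon (hyz.trans h))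
    (fun h => hA _ _ hxy (hyz.trans h)) ((hyz.symm hE).trans hxy)
  exact hirr _ (h.1.edge exy)

/-! ### Adding an undecided implication class to a closed orientation -/

section Extend

variable {T : α → α → Prop} {p : α × α}

/-- An edge of `T` between two edges of the new class can be absorbed. Either (x, z) is in the
class, or the triangle lemma with apex z produces the loop (z, z). -/
theorem IsClosedOrientation.collapse (hE : ∀ x y, E x y → E y x) (hirr : ∀ x, ¬ E x x)
    (hT : IsClosedOrientation E T) (hp : E p.1 p.2)
    (hA : ∀ x y, SameClass E p (x, y) → ¬ SameClass E p (y, x))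
    (hpT : ¬ T p.1 p.2) (hpT' : ¬ T p.2 p.1) {x y z w : α} (hxy : SameClass E p (x, y))
    (hyz : T y z) (hzw : SameClass E p (z, w)) : SameClass E p (x, w) := by
  have dis : ∀ {u v}, SameClass E p (u, v) → ¬ T u v := fun h h' =>
    hpT (hT.sameClass h' (h.symm hE))
  have dis' : ∀ {u v}, SameClass E p (u, v) → ¬ T v u := fun h h' =>
    hpT' (hT.sameClass h' ((h.symm hE).swap hE))
  have exy : E x y := hxy.edge hp
  have eyz : E y z := hT.edge hyz
  have exz : E x z := by
    by_contra h
    exact dis' (hxy.tail (.right exy (hE _ _ eyz) h)) hyz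
  by_cases h1 : SameClass E p (x, z)
  · exact SameClass.trans_of_asymm hE hirr hp hA h1 hzw
  · have h := SameClass.triangle hE (hE _ _ exz) (hE _ _ eyz)
      (fun h => dis' (hxy.trans h) hyz) (fun h => h1 (hxy.trans h)) ((hxy.symm hE).trans hzw)
    exact absurd (h.1.edge (hE _ _ exz)) (hirr _)

/-- By collapsing, a path that uses the class at all shrinks to one edge of the class with at most
one edge of `T` on each side. A closed path of this form would place the reverse of a class edge in
`T`. -/
theorem IsClosedOrientation.transGen_irrefl (hE : ∀ x y, E x y → E y x) (hirr : ∀ x, ¬ E x x)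
    (hT : IsClosedOrientation E T) (hp : E p.1 p.2)
    (hA : ∀ x y, SameClass E p (x, y) → ¬ SameClass E p (y, x))
    (hpT : ¬ T p.1 p.2) (hpT' : ¬ T p.2 p.1) (x : α) :
    ¬ Relation.TransGen (fun x y => T x y ∨ SameClass E p (x, y)) x x := by
  have key : ∀ x y, Relation.TransGen (fun x y => T x y ∨ SameClass E p (x, y)) x y →
      T x y ∨ ∃ u v, (x = u ∨ T x u) ∧ SameClass E p (u, v) ∧ (v = y ∨ T v y) := by
    intro x y h
    induction h with
    | single h =>
      exact h.imp id fun h => ⟨_, _, Or.inl rfl, h, Or.inl rfl⟩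
    | @tail y z _ hs ih =>
      rcases ih with h | ⟨u, v, hxu, huv, hvy⟩
      · rcases hs with hs | hs
        · exact Or.inl (hT.trans h hs)
        · exact Or.inr ⟨_, _, Or.inr h, hs, Or.inl rfl⟩
      · rcases hs with hs | hs
        · refine Or.inr ⟨u, v, hxu, huv, Or.inr ?_⟩
          rcases hvy with rfl | hvy
          · exact hs
          · exact hT.trans hvy hs
        · refine Or.inr ⟨u, z, hxu, ?_, Or.inl rfl⟩
          rcases hvy with rfl | hvy
          · exact SameClass.trans_of_asymm hE hirr hp hA huv hs
          · exact hT.collapse hE hirr hp hA hpT hpT' huv hvy hs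
  intro h
  rcases key x x h with h | ⟨u, v, hxu, huv, hvx⟩
  · exact hirr _ (hT.edge h)
  · have hvu : v = u ∨ T v u := by
      rcases hvx with rfl | hvx
      · exact hxu
      · rcases hxu with rfl | hxu
        · exact Or.inr hvx
        · exact Or.inr (hT.trans hvx hxu)
    rcases hvu with rfl | hvu
    · exact hirr _ (huv.edge hp)
    · exact hpT' (hT.sameClass hvu ((huv.symm hE).swap hE))

/-- Acyclicity makes every shortcut (x, z) of a path x, y, z an edge. Whatever (x, z) forces is
again a shortcut: if its class is neither that of (x, y) nor that of (y, z), the triangle lemma with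
apex y splits each of its members into two steps through y. -/
theorem IsClosedOrientation.transGen (hE : ∀ x y, E x y → E y x) (hirr : ∀ x, ¬ E x x)
    (hT : IsClosedOrientation E T) (hp : E p.1 p.2)
    (hA : ∀ x y, SameClass E p (x, y) → ¬ SameClass E p (y, x))
    (hpT : ¬ T p.1 p.2) (hpT' : ¬ T p.2 p.1) :
    IsClosedOrientation E
      (Relation.TransGen fun x y => T x y ∨ SameClass E p (x, y)) := by
  set S : α → α → Prop := fun x y => T x y ∨ SameClass E p (x, y) with hS
  have hacyc := hT.transGen_irrefl hE hirr hp hA hpT hpT'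
  have hSe : ∀ {x y}, S x y → E x y := by
    rintro x y (h | h)
    · exact hT.edge h
    · exact h.edge hp
  have hSc : ∀ {x y u v}, S x y → SameClass E (x, y) (u, v) → S u v := by
    rintro x y u v (h | h) h'
    · exact Or.inl (hT.sameClass h h')
    · exact Or.inr (h.trans h')
  have key : ∀ x z, Relation.TransGen S x z →
      E x z ∧ ∀ q, SameClass E (x, z) q → Relation.TransGen S q.1 q.2 := by
    intro x z h
    induction h with
    | single h => exact ⟨hSe h, fun q hq => .single (hSc h hq)⟩
    | @tail y z hxy hs ih =>
      obtain ⟨exy, ih⟩ := ih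
      have eyz := hSe hs
      have exz : E x z := by
        by_contra h
        exact hacyc y (.head hs (ih (z, y) (.single (.right exy (hE _ _ eyz) h))))
      refine ⟨exz, fun q hq => ?_⟩
      by_cases h1 : SameClass E (x, z) (x, y)
      · exact ih q ((h1.symm hE).trans hq)
      by_cases h2 : SameClass E (x, z) (y, z)
      · exact .single (hSc hs ((h2.symm hE).trans hq))
      obtain ⟨t1, t2⟩ := SameClass.triangle hE (hE _ _ exy) eyz h2 h1 hq
      exact (ih (q.1, y) (t1.swap hE)).tail (hSc hs t2)
  exact
    { edge := fun h => (key _ _ h).1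
      asymm := fun h h' => hacyc _ (h.trans h')
      trans := fun h h' => h.trans h'
      forces := fun h h' => (key _ _ h).2 (_, _) (.single h') }

end Extend

/-- If `E` has a transitive orientation, then every closed set of oriented edges extends to one. -/
theorem IsClosedOrientation.exists_total [Finite α] (hE : ∀ x y, E x y → E y x)
    {F T : α → α → Prop} (hF : IsClosedOrientation E F) (hFt : ∀ x y, E x y → F x y ∨ F y x)
    (hT : IsClosedOrientation E T) :
    ∃ T', IsClosedOrientation E T' ∧ T ≤ T' ∧ ∀ x y, E x y → T' x y ∨ T' y x := by
  obtain ⟨T', hle, hmax⟩ := Finite.exists_le_maximal hT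
  refine ⟨T', hmax.prop, hle, fun a b hab => ?_⟩
  have hirr : ∀ x, ¬ E x x := fun x h => by
    rcases hFt x x h with h | h <;> exact hF.asymm h h
  have hA := hF.sameClass_asymm hE (hFt a b hab)
  by_contra hcon
  push Not at hcon
  -- An edge undecided by a maximal closed set could still be added together with its class.
  have hU := hmax.prop.transGen (p := (a, b)) hE hirr hab hA hcon.1 hcon.2
  exact hcon.1 (hmax.le_of_ge hU (fun x y h => .single (Or.inl h)) a b
    (.single (Or.inr .refl)))

end Orientation

/-- `x` and `y` are incomparable. -/
def Incomp {α : Type*} [PartialOrder α] (x y : α) : Prop := ¬ x ≤ y ∧ ¬ y ≤ x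

theorem Incomp.symm {α : Type*} [PartialOrder α] {x y : α} (h : Incomp x y) : Incomp y x :=
  ⟨h.2, h.1⟩

/-! ### Conjugate orders as transitive orientations of the incomparability graph -/

section

variable {α : Type*} [PartialOrder α]

theorem IsConjugateOrder.incomp {Q : α → α → Prop} (hQ : IsConjugateOrder Q) {x y : α}
    (h : Q x y) : Incomp x y := ⟨hQ.not_le h, hQ.not_ge h⟩

theorem IsConjugateOrder.left_of_right {Q : α → α → Prop} (hQ : IsConjugateOrder Q) {a b c : α}
    (hab : Q a b) (hac : Incomp a c) (hbc : ¬ Incomp b c) : Q a c := by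
  rcases hQ.total hac.1 hac.2 with h' | h'
  · exact h'
  · exact absurd (hQ.incomp (hQ.trans h' hab)).symm hbc

theorem IsConjugateOrder.right_of_left {Q : α → α → Prop} (hQ : IsConjugateOrder Q) {a b c : α}
    (hab : Q a b) (hcb : Incomp c b) (hac : ¬ Incomp a c) : Q c b := by
  rcases hQ.total hcb.1 hcb.2 with h' | h'
  · exact h'
  · exact absurd (hQ.incomp (hQ.trans hab h')) hac

theorem IsConjugateOrder.isClosedOrientation {Q : α → α → Prop} (hQ : IsConjugateOrder Q) :
    IsClosedOrientation Incomp Q where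
  edge h := hQ.incomp h
  asymm h := hQ.asymm h
  trans h h' := hQ.trans h h'
  forces h h' := by
    cases h' with
    | left _ h' hn => exact hQ.left_of_right h h' hn
    | right _ h' hn => exact hQ.right_of_left h h' hn

theorem IsClosedOrientation.isConjugateOrder {Q : α → α → Prop}
    (hQ : IsClosedOrientation Incomp Q) (h : ∀ x y : α, Incomp x y → Q x y ∨ Q y x) :
    IsConjugateOrder Q where
  not_le h := (hQ.edge h).1
  not_ge h := (hQ.edge h).2
  total h1 h2 := h _ _ ⟨h1, h2⟩
  asymm h := hQ.asymm h
  trans h h' := hQ.trans h h'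

/-- In a part of a conjugate order that is closed under forcing and transitivity, an undecided
pair can be oriented arbitrarily. -/
theorem IsConjugateOrder.exists_extension [Finite α] {Q T : α → α → Prop}
    (hQ : IsConjugateOrder Q) (hTQ : ∀ x y, T x y → Q x y)
    (htrans : ∀ a b c, T a b → T b c → T a c)
    (hleft : ∀ a b c, T a b → Incomp a c → ¬ Incomp b c → T a c)
    (hright : ∀ a b c, T a b → Incomp b c → ¬ Incomp a c → T c b)
    {a b : α} (hab : Incomp a b) (h : ¬ T a b) (h' : ¬ T b a) :
    ∃ Q' : α → α → Prop, IsConjugateOrder Q' ∧ (∀ x y, T x y → Q' x y) ∧ Q' a b := by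
  have hE : ∀ x y : α, Incomp x y → Incomp y x := fun x y h => h.symm
  have hF := hQ.isClosedOrientation
  have hFt : ∀ x y, Incomp x y → Q x y ∨ Q y x := fun x y h => hQ.total h.1 h.2
  have hT : IsClosedOrientation Incomp T :=
    { edge := fun h => hQ.incomp (hTQ _ _ h)
      asymm := fun h h' => hQ.asymm (hTQ _ _ h) (hTQ _ _ h')
      trans := fun h h' => htrans _ _ _ h h'
      forces := fun h h' => by
        cases h' with
        | left _ h' hn => exact hleft _ _ _ h h' hn
        | right _ h' hn => exact hright _ _ _ h h'.symm hn }
  have hirr : ∀ x : α, ¬ Incomp x x := fun x h => h.1 le_rfl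
  have hA := hF.sameClass_asymm hE (hFt a b hab)
  -- The given conjugate order may orient the pair the other way; it only certifies that implication
  -- classes are asymmetric.
  have hU := hT.transGen (p := (a, b)) hE hirr hab hA h h'
  obtain ⟨Q', hQ', hle, ht⟩ := IsClosedOrientation.exists_total hE hF hFt hU
  exact ⟨Q', hQ'.isConjugateOrder ht, fun x y h => hle x y (.single (Or.inl h)),
    hle a b (.single (Or.inr .refl))⟩

end

/-! ### A small programming language with square arrays

Programs of this language have variables and `n × n` arrays; their loops run over the numbers
below `n`. They are compiled to programs for the random access machine. -/

/-- The values of the variables and of the entries of the arrays. -/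
structure ArrState where
  var : ℕ → ℕ
  arr : ℕ → ℕ → ℕ → ℕ

/-- Assign a value to a variable. -/
def ArrState.setVar (σ : ArrState) (i v : ℕ) : ArrState :=
  ⟨fun j => if j = i then v else σ.var j, σ.arr⟩

/-- Assign a value to an entry of an array. -/
def ArrState.setArr (σ : ArrState) (k a b v : ℕ) : ArrState :=
  ⟨σ.var, fun k' a' b' => if k' = k ∧ a' = a ∧ b' = b then v else σ.arr k' a' b'⟩

@[simp] theorem ArrState.setVar_var (σ : ArrState) (i v j : ℕ) :
    (σ.setVar i v).var j = if j = i then v else σ.var j := rfl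

@[simp] theorem ArrState.setVar_arr (σ : ArrState) (i v : ℕ) : (σ.setVar i v).arr = σ.arr := rfl

@[simp] theorem ArrState.setArr_var (σ : ArrState) (k a b v : ℕ) :
    (σ.setArr k a b v).var = σ.var := rfl

@[simp] theorem ArrState.setArr_arr (σ : ArrState) (k a b v k' a' b' : ℕ) :
    (σ.setArr k a b v).arr k' a' b' =
      if k' = k ∧ a' = a ∧ b' = b then v else σ.arr k' a' b' := rfl

/-- Expressions. -/
inductive ArrExpr where
  | var (i : ℕ)
  | lit (k : ℕ)
  | op (o : RamOp) (a b : ArrExpr)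
  | get (k : ℕ) (a b : ArrExpr)

namespace ArrExpr

/-- The value of an expression. -/
def eval (σ : ArrState) : ArrExpr → ℕ
  | var i => σ.var i
  | lit k => k
  | op o a b => o.eval (a.eval σ) (b.eval σ)
  | get k a b => σ.arr k (a.eval σ) (b.eval σ)

/-- The evaluation stays within the bounds of the words and of the arrays. -/
def Fits (w n : ℕ) (σ : ArrState) : ArrExpr → Prop
  | var i => i < 15 ∧ σ.var i < 2 ^ w
  | lit k => k < 2 ^ w
  | op o a b => a.Fits w n σ ∧ b.Fits w n σ ∧ o.eval (a.eval σ) (b.eval σ) < 2 ^ w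
  | get k a b => a.Fits w n σ ∧ b.Fits w n σ ∧ k < 4 ∧ a.eval σ < n ∧ b.eval σ < n

/-- Evaluate the expression into register `d`, using registers from `d` on. -/
def compile : ArrExpr → ℕ → RamProg
  | var i, d => .seq (.const d 0) (.op .add d (i + 1) d)
  | lit k, d => .const d k
  | op o a b, d => .seq (a.compile d) (.seq (b.compile (d + 1)) (.op o d d (d + 1)))
  | get k a b, d => .seq (a.compile d) (.seq (b.compile (d + 1)) (.seq (.const (d + 2) k)
      (.seq (.op .mul (d + 2) (d + 2) 0) (.seq (.op .add d (d + 2) d) (.seq (.op .mul d d 0)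
        (.seq (.op .add d d (d + 1)) (.load d d)))))))

/-- The time that the evaluation takes. -/
def cost : ArrExpr → ℕ
  | var _ => 2
  | lit _ => 1
  | op _ a b => a.cost + (b.cost + 1)
  | get _ a b => a.cost + (b.cost + 6)

end ArrExpr

/-- The machine state `s` represents `σ`. -/
structure ArrState.Encodes (n : ℕ) (σ : ArrState) (s : RamState) : Prop where
  size : s.reg 0 = n
  var : ∀ i < 15, s.reg (i + 1) = σ.var i
  arr : ∀ k < 4, ∀ a < n, ∀ b < n, s.mem ((k * n + a) * n + b) = σ.arr k a b

theorem ArrState.Encodes.of_reg {n : ℕ} {σ : ArrState} {s s' : RamState} (h : σ.Encodes n s)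
    (hreg : ∀ r < 16, s'.reg r = s.reg r) (hmem : s'.mem = s.mem) : σ.Encodes n s' where
  size := by rw [hreg 0 (by omega), h.size]
  var i hi := by rw [hreg _ (by omega), h.var i hi]
  arr k hk a ha b hb := by rw [hmem, h.arr k hk a ha b hb]

theorem address_lt {n k a b : ℕ} (hk : k < 4) (ha : a < n) (hb : b < n) :
    (k * n + a) * n + b < 4 * n * n := by
  have h1 : k * n + a + 1 ≤ 4 * n := by nlinarith
  calc _ < (k * n + a) * n + n := by omega
    _ = (k * n + a + 1) * n := by ring
    _ ≤ _ := Nat.mul_le_mul_right _ h1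

theorem address_inj {n k a b k' a' b' : ℕ} (ha : a < n) (hb : b < n) (ha' : a' < n) (hb' : b' < n) :
    (k * n + a) * n + b = (k' * n + a') * n + b' ↔ k = k' ∧ a = a' ∧ b = b' := by
  constructor
  · intro h
    have hn : 0 < n := by omega
    have key : ∀ x y z : ℕ, z < n → (x * n + z) % n = z ∧ (x * n + z) / n = x := by
      intro x y z hz
      constructor
      · rw [mul_comm, Nat.mul_add_mod, Nat.mod_eq_of_lt hz]
      · rw [mul_comm, Nat.mul_add_div hn, Nat.div_eq_of_lt hz, add_zero]
    have e1 : b = b' := by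
      rw [← (key (k * n + a) 0 b hb).1, h, (key _ 0 b' hb').1]
    have e2 : k * n + a = k' * n + a' := by
      rw [← (key (k * n + a) 0 b hb).2, h, (key _ 0 b' hb').2]
    have e3 : a = a' := by
      rw [← (key k 0 a ha).1, e2, (key _ 0 a' ha').1]
    have e4 : k = k' := by
      rw [← (key k 0 a ha).2, e2, (key _ 0 a' ha').2]
    exact ⟨e4, e3, e1⟩
  · rintro ⟨rfl, rfl, rfl⟩
    rfl

/-- The bound on `w` makes all addresses of the four arrays and the array numbers fit. Registers 0
to 15 hold n and the variables, so scratch space starts at 16. -/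
theorem ArrExpr.exec_compile {w n : ℕ} (hw : 4 * n * n + 4 ≤ 2 ^ w) {σ : ArrState} (e : ArrExpr) :
    ∀ (d : ℕ) (s : RamState), 16 ≤ d → σ.Encodes n s → e.Fits w n σ →
      ∃ s', (e.compile d).Exec w s e.cost s' ∧ s'.reg d = e.eval σ ∧ s'.mem = s.mem ∧
        ∀ r < d, s'.reg r = s.reg r := by
  induction e with
  | var i =>
    intro d s hd hs hf
    have hi : s.reg (i + 1) = σ.var i := hs.var i hf.1
    have hne : i + 1 ≠ d := by have := hf.1; omega
    refine ⟨_, .seq (.const _ _ _ (by omega)) (.op _ _ _ _ _ ?_), ?_, rfl, ?_⟩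
    · simp [RamOp.eval, hne, hi, hf.2]
    · simp [RamOp.eval, hne, hi, ArrExpr.eval]
    · intro r hr
      have : r ≠ d := by omega
      simp [this]
  | lit k =>
    intro d s hd hs hf
    refine ⟨_, .const _ _ _ hf, ?_, rfl, ?_⟩
    · simp [ArrExpr.eval]
    · intro r hr
      have : r ≠ d := by omega
      simp [this]
  | op o a b iha ihb =>
    intro d s hd hs hf
    obtain ⟨fa, fb, fo⟩ := hf
    obtain ⟨s1, x1, v1, m1, r1⟩ := iha d s hd hs fa
    obtain ⟨s2, x2, v2, m2, r2⟩ := ihb (d + 1) s1 (by omega)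
      (hs.of_reg (fun r hr => r1 r (by omega)) m1) fb
    have v1' : s2.reg d = a.eval σ := by rw [r2 d (by omega), v1]
    refine ⟨_, .seq x1 (.seq x2 (.op _ _ _ _ _ ?_)), ?_, ?_, ?_⟩
    · rw [v1', v2]
      exact fo
    · simp [v1', v2, ArrExpr.eval]
    · exact m2.trans m1
    · intro r hr
      have : r ≠ d := by omega
      simp [this, r2 r (by omega), r1 r hr]
  | get k a b iha ihb =>
    intro d s hd hs hf
    obtain ⟨fa, fb, hk, ha, hb⟩ := hf
    obtain ⟨s1, x1, v1, m1, r1⟩ := iha d s hd hs fa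
    obtain ⟨s2, x2, v2, m2, r2⟩ := ihb (d + 1) s1 (by omega)
      (hs.of_reg (fun r hr => r1 r (by omega)) m1) fb
    have v1' : s2.reg d = a.eval σ := by rw [r2 d (by omega), v1]
    have h0 : s2.reg 0 = n := by rw [r2 0 (by omega), r1 0 (by omega), hs.size]
    have hlt := address_lt hk ha hb
    have hd0 : (0 : ℕ) ≠ d := by omega
    have hn : 0 < n := by omega
    have hlt2 : (k * n + a.eval σ) * n < 2 ^ w := by omega
    have hlt1 : k * n + a.eval σ < 2 ^ w :=
      lt_of_le_of_lt (Nat.le_mul_of_pos_right _ hn) hlt2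
    refine ⟨_, .seq x1 (.seq x2 (.seq (.const _ _ _ (by omega)) (.seq (.op _ _ _ _ _ ?_)
      (.seq (.op _ _ _ _ _ ?_) (.seq (.op _ _ _ _ _ ?_) (.seq (.op _ _ _ _ _ ?_)
        (.load _ _ _))))))), ?_, ?_, ?_⟩
    · simp [RamOp.eval, h0]
      omega
    · simp [RamOp.eval, h0, v1']
      omega
    · simp [RamOp.eval, h0, v1', hd0]
      omega
    · simp [RamOp.eval, h0, v1', v2, hd0]
      omega
    · simp [RamOp.eval, h0, v1', v2, hd0, m2, m1, ArrExpr.eval]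
      exact hs.arr k hk _ ha _ hb
    · exact m2.trans m1
    · intro r hr
      have h1 : r ≠ d := by omega
      have h2 : r ≠ d + 2 := by omega
      simp [h1, h2, r2 r (by omega), r1 r hr]

/-- Statements. The statement `loop i p` runs `p` for the values `n - 1, …, 0` of variable `i`. -/
inductive ArrStmt where
  | skip
  | set (i : ℕ) (e : ArrExpr)
  | put (k : ℕ) (a b e : ArrExpr)
  | seq (p q : ArrStmt)
  | ite (e : ArrExpr) (p q : ArrStmt)
  | loop (i : ℕ) (p : ArrStmt)

/-! ### Weakest preconditions, compilation and running time of statements -/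

namespace ArrStmt

/-- The weakest precondition for a run within the bounds of the words and of the arrays. -/
def wp (w n : ℕ) : ArrStmt → (ArrState → Prop) → ArrState → Prop
  | skip, P => P
  | set i e, P => fun σ => i < 15 ∧ e.Fits w n σ ∧ e.eval σ < 2 ^ w ∧ P (σ.setVar i (e.eval σ))
  | put k a b e, P => fun σ => k < 4 ∧ a.Fits w n σ ∧ b.Fits w n σ ∧ e.Fits w n σ ∧
      a.eval σ < n ∧ b.eval σ < n ∧ P (σ.setArr k (a.eval σ) (b.eval σ) (e.eval σ))
  | seq p q, P => p.wp w n (q.wp w n P)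
  | ite e p q, P => fun σ => e.Fits w n σ ∧ (e.eval σ ≠ 0 → p.wp w n P σ) ∧
      (e.eval σ = 0 → q.wp w n P σ)
  | loop i p, P => fun σ => i < 15 ∧
      Nat.rec (motive := fun _ => ArrState → Prop) P
        (fun k W σ => p.wp w n W (σ.setVar i k)) n σ

/-- The translation into a machine program that uses the registers from `d` on as scratch. -/
def compile : ArrStmt → ℕ → RamProg
  | skip, _ => .skip
  | set i e, d => .seq (e.compile d) (.seq (.const (d + 1) 0) (.op .add (i + 1) d (d + 1)))
  | put k a b e, d => .seq (a.compile d) (.seq (b.compile (d + 1)) (.seq (e.compile (d + 2))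
      (.seq (.const (d + 3) k) (.seq (.op .mul (d + 3) (d + 3) 0) (.seq (.op .add d (d + 3) d)
        (.seq (.op .mul d d 0) (.seq (.op .add d d (d + 1)) (.store d (d + 2)))))))))
  | seq p q, d => .seq (p.compile d) (q.compile d)
  | ite e p q, d => .seq (e.compile d) (.ite d (p.compile d) (q.compile d))
  | loop i p, d => .seq (.const d 0) (.seq (.op .add d 0 d) (.loop d
      (.seq (.const (d + 1) 1) (.seq (.op .sub d d (d + 1)) (.seq (.const (d + 1) 0)
        (.seq (.op .add (i + 1) d (d + 1)) (p.compile (d + 1))))))))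

/-- A bound for the running time. -/
def cost (n : ℕ) : ArrStmt → ℕ
  | skip => 1
  | set _ e => e.cost + 2
  | put _ a b e => a.cost + b.cost + e.cost + 6
  | seq p q => p.cost n + q.cost n
  | ite e p q => e.cost + 1 + p.cost n + q.cost n
  | loop _ p => 3 + n * (5 + p.cost n)

/-- The nesting depth of loops. -/
def depth : ArrStmt → ℕ
  | skip => 0
  | set _ _ => 0
  | put _ _ _ _ => 0
  | seq p q => max p.depth q.depth
  | ite _ p q => max p.depth q.depth
  | loop _ p => p.depth + 1

theorem exists_cost_le (p : ArrStmt) : ∃ K, ∀ n, p.cost n ≤ K * (n + 1) ^ p.depth := by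
  have mono : ∀ {K n a b : ℕ}, a ≤ b → K * (n + 1) ^ a ≤ K * (n + 1) ^ b := fun h =>
    Nat.mul_le_mul_left _ (Nat.pow_le_pow_right (by omega) h)
  induction p with
  | skip => exact ⟨1, fun n => by simp [cost, depth]⟩
  | set i e => exact ⟨_, fun n => by simp [cost, depth]; exact le_rfl⟩
  | put k a b e => exact ⟨_, fun n => by simp [cost, depth]; exact le_rfl⟩
  | seq p q ihp ihq =>
    obtain ⟨K, hK⟩ := ihp
    obtain ⟨L, hL⟩ := ihq
    refine ⟨K + L, fun n => ?_⟩
    rw [cost, depth, add_mul]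
    exact add_le_add ((hK n).trans (mono (le_max_left _ _))) ((hL n).trans (mono (le_max_right _ _)))
  | ite e p q ihp ihq =>
    obtain ⟨K, hK⟩ := ihp
    obtain ⟨L, hL⟩ := ihq
    refine ⟨e.cost + 1 + K + L, fun n => ?_⟩
    rw [cost, depth, add_mul, add_mul]
    refine add_le_add (add_le_add ?_ ((hK n).trans (mono (le_max_left _ _))))
      ((hL n).trans (mono (le_max_right _ _)))
    exact Nat.le_mul_of_pos_right _ (by positivity)
  | loop i p ihp =>
    obtain ⟨K, hK⟩ := ihp
    refine ⟨8 + K, fun n => ?_⟩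
    rw [cost, depth]
    have h1 : 1 ≤ (n + 1) ^ p.depth := Nat.one_le_pow _ _ (by omega)
    calc 3 + n * (5 + p.cost n) ≤ 3 + n * (5 + K * (n + 1) ^ p.depth) := by
          gcongr
          exact hK n
      _ ≤ (8 + K) * (n + 1) ^ (p.depth + 1) := by
          rw [pow_succ]
          nlinarith [Nat.zero_le (K * (n + 1) ^ p.depth), Nat.zero_le n,
            Nat.mul_le_mul_left n h1]

/-- Scratch registers below d hold the counters of the enclosing loops; the last clause keeps them
intact, which the induction needs for loops. -/
theorem exec_compile {w n : ℕ} (hw : 4 * n * n + 4 ≤ 2 ^ w) (p : ArrStmt) :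
    ∀ (P : ArrState → Prop) (σ : ArrState) (d : ℕ) (s : RamState), 16 ≤ d → σ.Encodes n s →
      p.wp w n P σ → ∃ t s' σ', t ≤ p.cost n ∧ (p.compile d).Exec w s t s' ∧
        ArrState.Encodes n σ' s' ∧ P σ' ∧ ∀ r, 16 ≤ r → r < d → s'.reg r = s.reg r := by
  induction p with
  | skip =>
    intro P σ d s hd hs h
    exact ⟨1, s, σ, le_rfl, .skip _, hs, h, fun _ _ _ => rfl⟩
  | set i e =>
    intro P σ d s hd hs h
    obtain ⟨hi, hf, hv, hP⟩ := h
    obtain ⟨s1, x1, v1, m1, r1⟩ := e.exec_compile hw d s hd hs hf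
    refine ⟨_, _, _, le_rfl, .seq x1 (.seq (.const _ _ _ (by omega)) (.op _ _ _ _ _ ?_)), ?_, hP,
      ?_⟩
    · simp [RamOp.eval, v1, hv]
    · constructor
      · have : (0 : ℕ) ≠ d + 1 := by omega
        simp [r1 0 (by omega), hs.size]
      · intro j hj
        by_cases hji : j = i
        · subst hji
          simp [RamOp.eval, v1]
        · have : j ≠ d := by omega
          simp [hji, this, r1 (j + 1) (by omega), hs.var j hj]
      · intro k hk a ha b hb
        simp [m1, hs.arr k hk a ha b hb]
    · intro r hr hrd
      have h1 : r ≠ d + 1 := by omega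
      have h2 : r ≠ i + 1 := by omega
      simp [h1, h2, r1 r hrd]
  | put k a b e =>
    intro P σ d s hd hs h
    obtain ⟨hk, fa, fb, fe, ha, hb, hP⟩ := h
    obtain ⟨s1, x1, v1, m1, r1⟩ := a.exec_compile hw d s hd hs fa
    have hs1 := hs.of_reg (fun r hr => r1 r (by omega)) m1
    obtain ⟨s2, x2, v2, m2, r2⟩ := b.exec_compile hw (d + 1) s1 (by omega) hs1 fb
    have hs2 := hs1.of_reg (fun r hr => r2 r (by omega)) m2
    obtain ⟨s3, x3, v3, m3, r3⟩ := e.exec_compile hw (d + 2) s2 (by omega) hs2 fe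
    have hs3 := hs2.of_reg (fun r hr => r3 r (by omega)) m3
    have v1' : s3.reg d = a.eval σ := by rw [r3 d (by omega), r2 d (by omega), v1]
    have v2' : s3.reg (d + 1) = b.eval σ := by rw [r3 (d + 1) (by omega), v2]
    have h0 := hs3.size
    have hlt := address_lt hk ha hb
    have hd0 : (0 : ℕ) ≠ d := by omega
    have hn : 0 < n := by omega
    have hlt2 : (k * n + a.eval σ) * n < 2 ^ w := by omega
    have hlt1 : k * n + a.eval σ < 2 ^ w :=
      lt_of_le_of_lt (Nat.le_mul_of_pos_right _ hn) hlt2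
    refine ⟨_, _, _, ?_, .seq x1 (.seq x2 (.seq x3 (.seq (.const _ _ _ (by omega))
      (.seq (.op _ _ _ _ _ ?_) (.seq (.op _ _ _ _ _ ?_) (.seq (.op _ _ _ _ _ ?_)
        (.seq (.op _ _ _ _ _ ?_) (.store _ _ _)))))))), ?_, hP, ?_⟩
    · simp only [cost]
      omega
    · simp [RamOp.eval, h0]
      omega
    · simp [RamOp.eval, h0, v1']
      omega
    · simp [RamOp.eval, h0, v1', hd0]
      omega
    · simp [RamOp.eval, h0, v1', v2', hd0]
      omega
    · constructor
      · simp [hd0, h0]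
      · intro j hj
        have h1 : j + 1 ≠ d := by omega
        have h2 : j ≠ d + 2 := by omega
        simp [h1, h2, hs3.var j hj]
      · intro k' hk' a' ha' b' hb'
        simp [RamOp.eval, h0, v1', v2', hd0, v3, Function.update_apply, address_inj ha' hb' ha hb,
          hs3.arr k' hk' a' ha' b' hb']
    · intro r hr hrd
      have h1 : r ≠ d := by omega
      have h2 : r ≠ d + 3 := by omega
      simp [h1, h2, r3 r (by omega), r2 r (by omega), r1 r hrd]
  | seq p q ihp ihq =>
    intro P σ d s hd hs h
    obtain ⟨t1, s1, σ1, c1, x1, e1, h1, r1⟩ := ihp _ σ d s hd hs h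
    obtain ⟨t2, s2, σ2, c2, x2, e2, h2, r2⟩ := ihq _ σ1 d s1 hd e1 h1
    exact ⟨_, s2, σ2, add_le_add c1 c2, .seq x1 x2, e2, h2,
      fun r hr hrd => (r2 r hr hrd).trans (r1 r hr hrd)⟩
  | ite e p q ihp ihq =>
    intro P σ d s hd hs h
    obtain ⟨hf, hp, hq⟩ := h
    obtain ⟨s1, x1, v1, m1, r1⟩ := e.exec_compile hw d s hd hs hf
    have hs1 := hs.of_reg (fun r hr => r1 r (by omega)) m1
    by_cases h0 : e.eval σ = 0
    · obtain ⟨t2, s2, σ2, c2, x2, e2, h2, r2⟩ := ihq _ σ d s1 hd hs1 (hq h0)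
      refine ⟨_, s2, σ2, ?_, .seq x1 (.ite_neg (v1.trans h0) x2), e2, h2,
        fun r hr hrd => (r2 r hr hrd).trans (r1 r hrd)⟩
      simp only [cost]
      omega
    · obtain ⟨t2, s2, σ2, c2, x2, e2, h2, r2⟩ := ihp _ σ d s1 hd hs1 (hp h0)
      refine ⟨_, s2, σ2, ?_, .seq x1 (.ite_pos (by rwa [v1]) x2), e2, h2,
        fun r hr hrd => (r2 r hr hrd).trans (r1 r hrd)⟩
      simp only [cost]
      omega
  | loop i p ihp =>
    intro P σ d s hd hs h
    obtain ⟨hi, h⟩ := h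
    have hd0 : (0 : ℕ) ≠ d := by omega
    -- Induction on the number m of rounds left. It is kept in register d, apart from the loop
    -- variable, and the body is compiled with scratch space from d + 1 on.
    have key : ∀ m ≤ n, ∀ (σ : ArrState) (s : RamState), σ.Encodes n s → s.reg d = m →
        Nat.rec (motive := fun _ => ArrState → Prop) P
          (fun k W σ => p.wp w n W (σ.setVar i k)) m σ →
        ∃ t s' σ', t ≤ 1 + m * (5 + p.cost n) ∧
          (RamProg.loop d (.seq (.const (d + 1) 1) (.seq (.op .sub d d (d + 1))
            (.seq (.const (d + 1) 0) (.seq (.op .add (i + 1) d (d + 1))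
              (p.compile (d + 1))))))).Exec w s t s' ∧
          ArrState.Encodes n σ' s' ∧ P σ' ∧ ∀ r, 16 ≤ r → r < d → s'.reg r = s.reg r := by
      intro m
      induction m with
      | zero =>
        intro _ σ s hs hm h
        exact ⟨1, s, σ, by omega, .loop_neg hm, hs, h, fun _ _ _ => rfl⟩
      | succ m ih =>
        intro hmn σ s hs hm h
        have hmw : m < 2 ^ w := by nlinarith
        have hs1 : (σ.setVar i m).Encodes n
            ⟨Function.update (Function.update (Function.update (Function.update s.reg (d + 1) 1)
              d m) (d + 1) 0) (i + 1) m, s.mem⟩ := by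
          constructor
          · simp [hd0, hs.size]
          · intro j hj
            by_cases hji : j = i
            · subst hji
              simp
            · have h1 : j ≠ d := by omega
              have h2 : j + 1 ≠ d := by omega
              simp [hji, h1, h2, hs.var j hj]
          · intro k hk a ha b hb
            simp [hs.arr k hk a ha b hb]
        obtain ⟨t1, s1, σ1, c1, x1, e1, h1, r1⟩ := ihp _ _ (d + 1) _ (by omega) hs1 h
        have hid : d ≠ i + 1 := by omega
        obtain ⟨t2, s2, σ2, c2, x2, e2, h2, r2⟩ := ih (by omega) σ1 s1 e1
          (by rw [r1 d hd (by omega)]; simp [hid]) h1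
        refine ⟨1 + (1 + (1 + (1 + (1 + t1)))) + t2, s2, σ2, ?_, .loop_pos (by omega)
          (.seq (.const _ _ _ (by omega)) (.seq (.op _ _ _ _ _ ?_) (.seq (.const _ _ _ (by omega))
            (.seq (.op _ _ _ _ _ ?_) ?_)))) x2, e2, h2, ?_⟩
        · have : (m + 1) * (5 + p.cost n) = m * (5 + p.cost n) + (5 + p.cost n) := by ring
          omega
        · simp [RamOp.eval, hm, hmw]
        · simp [RamOp.eval, hm, hmw]
        · simpa [RamOp.eval, hm] using x1
        · intro r hr hrd
          have h1 : r ≠ i + 1 := by omega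
          have h2 : r ≠ d + 1 := by omega
          have h3 : r ≠ d := by omega
          rw [r2 r hr hrd, r1 r hr (by omega)]
          simp [h1, h2, h3]
    have hs1 : σ.Encodes n ⟨Function.update (Function.update s.reg d 0) d n, s.mem⟩ :=
      hs.of_reg (fun r hr => by simp [show r ≠ d by omega]) rfl
    obtain ⟨t, s', σ', c, x, e, h, r⟩ := key n le_rfl σ _ hs1 (by simp) h
    refine ⟨1 + (1 + t), s', σ', ?_, .seq (.const _ _ _ (by omega)) (.seq (.op _ _ _ _ _ ?_) ?_),
      e, h, ?_⟩
    · simp only [cost]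
      omega
    · have : n < 2 ^ w := by nlinarith [Nat.le_mul_self n]
      simpa [RamOp.eval, hd0, hs.size] using this
    · simpa [RamOp.eval, hd0, hs.size] using x
    · intro q hq hqd
      rw [r q hq hqd]
      simp [show q ≠ d by omega]

theorem wp_mono {w n : ℕ} (p : ArrStmt) : ∀ {P P' : ArrState → Prop}, (∀ σ, P σ → P' σ) →
    ∀ {σ}, p.wp w n P σ → p.wp w n P' σ := by
  induction p with
  | skip => exact fun h σ hσ => h _ hσ
  | set i e => exact fun h σ hσ => ⟨hσ.1, hσ.2.1, hσ.2.2.1, h _ hσ.2.2.2⟩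
  | put k a b e =>
    exact fun h σ ⟨h1, h2, h3, h4, h5, h6, h7⟩ => ⟨h1, h2, h3, h4, h5, h6, h _ h7⟩
  | seq p q ihp ihq => exact fun h σ hσ => ihp (fun _ h' => ihq h h') hσ
  | ite e p q ihp ihq =>
    exact fun h σ hσ => ⟨hσ.1, fun h0 => ihp h (hσ.2.1 h0), fun h0 => ihq h (hσ.2.2 h0)⟩
  | loop i p ih =>
    intro P P' h σ hσ
    refine ⟨hσ.1, ?_⟩
    have key : ∀ m σ, Nat.rec (motive := fun _ => ArrState → Prop) P
          (fun k W σ => p.wp w n W (σ.setVar i k)) m σ →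
        Nat.rec (motive := fun _ => ArrState → Prop) P'
          (fun k W σ => p.wp w n W (σ.setVar i k)) m σ := by
      intro m
      induction m with
      | zero => exact h
      | succ m ihm => exact fun σ hσ => ih ihm hσ
    exact key n σ hσ.2

theorem wp_seq {w n : ℕ} {p q : ArrStmt} {P R : ArrState → Prop} {σ : ArrState}
    (hp : p.wp w n R σ) (hq : ∀ σ, R σ → q.wp w n P σ) : (seq p q).wp w n P σ :=
  wp_mono p hq hp

/-- The rule for loops: `I k` is the invariant when `k` rounds are left. -/
theorem wp_loop {w n i : ℕ} {p : ArrStmt} {P : ArrState → Prop} (I : ℕ → ArrState → Prop)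
    {σ : ArrState} (hi : i < 15) (h0 : I n σ)
    (hstep : ∀ (k : Fin n) (σ), I (k + 1) σ → p.wp w n (I k) (σ.setVar i k))
    (hend : ∀ σ, I 0 σ → P σ) : (loop i p).wp w n P σ := by
  refine ⟨hi, ?_⟩
  have key : ∀ m ≤ n, ∀ σ, I m σ → Nat.rec (motive := fun _ => ArrState → Prop) P
      (fun k W σ => p.wp w n W (σ.setVar i k)) m σ := by
    intro m
    induction m with
    | zero => exact fun _ σ h => hend σ h
    | succ m ih =>
      exact fun hm σ h => wp_mono p (fun σ' h' => ih (by omega) σ' h') (hstep ⟨m, hm⟩ σ h)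
  exact key n le_rfl σ h0

end ArrStmt

/-! ### Computing a conjugate order

Array `0` holds the order, array `1` the orientation found so far. -/

namespace ArrStmt

/-- The entry of array `k` at two variables. -/
abbrev _root_.ArrExpr.at (k x y : ℕ) : ArrExpr := .get k (.var x) (.var y)

/-- Is zero if two elements are incomparable. -/
abbrev _root_.ArrExpr.comparable (x y : ℕ) : ArrExpr := .op .add (.at 0 x y) (.at 0 y x)

/-- Orient a pair and raise the flag in variable `5`. -/
def mark (x y : ℕ) : ArrStmt :=
  .ite (.at 1 x y) .skip (.seq (.put 1 (.var x) (.var y) (.lit 1)) (.set 5 (.lit 1)))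

/-- Apply the rules of forcing and transitivity to the elements in the variables `2`, `3`, `4`. -/
def propagateAt : ArrStmt :=
  .ite (.at 1 2 3)
    (.seq (.ite (.at 1 3 4) (mark 2 4) .skip)
      (.ite (.comparable 2 4)
        (.ite (.comparable 3 4) .skip (mark 4 3))
        (.ite (.comparable 3 4) (mark 2 4) .skip)))
    .skip

/-- Apply the rules of forcing and transitivity to all triples. -/
def propagate : ArrStmt := .loop 2 (.loop 3 (.loop 4 propagateAt))

/-- Orient the pair in the variables `2` and `3` if nothing was oriented so far. -/
def chooseAt : ArrStmt :=
  .ite (.var 5) .skip (.ite (.comparable 2 3) .skip (.ite (.at 1 3 2) .skip (mark 2 3)))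

/-- Orient some pair if nothing was oriented so far. -/
def choose : ArrStmt := .loop 2 (.loop 3 chooseAt)

/-- Orient at least one further pair. -/
def orientStep : ArrStmt := .seq (.set 5 (.lit 0)) (.seq propagate choose)

/-- Compute a conjugate order. -/
def orient : ArrStmt := .loop 0 (.loop 1 orientStep)

end ArrStmt

section Orient

variable {α : Type*} [PartialOrder α] {n : ℕ} (e : Fin n ≃ α)

open Classical in
/-- Array `0` holds the order. -/
def HoldsOrder (σ : ArrState) : Prop :=
  ∀ a b : Fin n, σ.arr 0 a b = if e a ≤ e b then 1 else 0

/-- The flag tells whether array `1` differs from `T`, which it contains; array `1` is contained in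
a conjugate order; if it equals `T`, then `X` holds. -/
structure OrientInv (T : Fin n → Fin n → Prop) (X : Prop) (σ : ArrState) : Prop where
  order : HoldsOrder e σ
  le_one : ∀ a b : Fin n, σ.arr 1 a b ≤ 1
  conj : ∃ Q : α → α → Prop, IsConjugateOrder Q ∧ ∀ a b : Fin n, σ.arr 1 a b ≠ 0 → Q (e a) (e b)
  mono : ∀ a b : Fin n, T a b → σ.arr 1 a b ≠ 0
  flag_le_one : σ.var 5 ≤ 1
  flag : σ.var 5 ≠ 0 → ∃ a b : Fin n, σ.arr 1 a b ≠ 0 ∧ ¬ T a b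
  eq : σ.var 5 = 0 → ∀ a b : Fin n, σ.arr 1 a b ≠ 0 → T a b
  holds : σ.var 5 = 0 → X
  zero : ∀ k, 2 ≤ k → ∀ a b : Fin n, σ.arr k a b = 0

variable {e} {T : Fin n → Fin n → Prop} {X Y : Prop} {σ : ArrState} {w : ℕ}

theorem HoldsOrder.comparable_eq_zero (h : HoldsOrder e σ) (a b : Fin n) :
    σ.arr 0 a b + σ.arr 0 b a = 0 ↔ Incomp (e a) (e b) := by
  rw [h a b, h b a, Incomp]
  by_cases h1 : e a ≤ e b <;> by_cases h2 : e b ≤ e a <;> simp [h1, h2]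

theorem HoldsOrder.le_one (h : HoldsOrder e σ) (a b : Fin n) : σ.arr 0 a b ≤ 1 := by
  rw [h a b]
  split_ifs <;> omega

/-- `X` accumulates what the scan has verified. It matters only while the flag is down, when array
`1` still equals `T`. -/
theorem OrientInv.congr (h : OrientInv e T X σ) (hXY : σ.var 5 = 0 → X → Y) : OrientInv e T Y σ :=
  { h with holds := fun h0 => hXY h0 (h.holds h0) }

theorem OrientInv.setVar (h : OrientInv e T X σ) {i v : ℕ} (hi : i ≠ 5) :
    OrientInv e T X (σ.setVar i v) := by
  have h5 : (σ.setVar i v).var 5 = σ.var 5 := by simp [hi.symm]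
  constructor
  · exact h.order
  · exact h.le_one
  · exact h.conj
  · exact h.mono
  · rw [h5]; exact h.flag_le_one
  · rw [h5]; exact h.flag
  · rw [h5]; exact h.eq
  · rw [h5]; exact h.holds
  · exact h.zero

/-- Raising the flag makes the conditional claim vacuous, so `Y` is arbitrary. The new pair is not
in `T`, as `T` is contained in array `1`; this witnesses progress. -/
theorem OrientInv.mark (h : OrientInv e T X σ) {a b : Fin n} (hab : σ.arr 1 a b = 0)
    (hQ : ∃ Q : α → α → Prop, IsConjugateOrder Q ∧
      (∀ a b : Fin n, σ.arr 1 a b ≠ 0 → Q (e a) (e b)) ∧ Q (e a) (e b)) :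
    OrientInv e T Y ((σ.setArr 1 a b 1).setVar 5 1) := by
  constructor
  · intro a' b'
    simpa using h.order a' b'
  · intro a' b'
    have := h.le_one a' b'
    simp only [ArrState.setVar_arr, ArrState.setArr_arr]
    split_ifs <;> omega
  · obtain ⟨Q, hQ, hle, hQab⟩ := hQ
    refine ⟨Q, hQ, fun a' b' => ?_⟩
    simp only [ArrState.setVar_arr, ArrState.setArr_arr]
    split_ifs with hc
    · obtain ⟨-, h1, h2⟩ := hc
      rw [Fin.ext h1, Fin.ext h2]
      exact fun _ => hQab
    · exact hle a' b'
  · intro a' b' hT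
    have := h.mono a' b' hT
    simp only [ArrState.setVar_arr, ArrState.setArr_arr]
    split_ifs <;> omega
  · simp
  · intro _
    refine ⟨a, b, by simp, fun hT => h.mono a b hT hab⟩
  · simp
  · simp
  · intro k hk a' b'
    have hk1 : k ≠ 1 := by omega
    simp [hk1, h.zero k hk a' b']

theorem ArrStmt.wp_mark {P : ArrState → Prop} {x y : ℕ} {a b : Fin n} (hw : n + 1 < 2 ^ w)
    (hx : x < 15) (hy : y < 15) (hxa : σ.var x = a) (hyb : σ.var y = b)
    (h1 : σ.arr 1 a b ≠ 0 → P σ)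
    (h2 : σ.arr 1 a b = 0 → P ((σ.setArr 1 a b 1).setVar 5 1)) : (mark x y).wp w n P σ := by
  have ha := a.2
  have hb := b.2
  simp only [mark, wp, ArrExpr.Fits, ArrExpr.eval, hxa, hyb]
  refine ⟨⟨⟨hx, by omega⟩, ⟨hy, by omega⟩, by omega, ha, hb⟩, h1, fun h => ?_⟩
  exact ⟨by omega, ⟨hx, by omega⟩, ⟨hy, by omega⟩, by omega, ha, hb, by omega, by omega, by omega,
    h2 h⟩

/-- The rules of forcing and transitivity at three elements. -/
def PropagatedAt (e : Fin n ≃ α) (T : Fin n → Fin n → Prop) (a b c : Fin n) : Prop :=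
  T a b → (T b c → T a c) ∧ (Incomp (e a) (e c) → ¬ Incomp (e b) (e c) → T a c) ∧
    (Incomp (e b) (e c) → ¬ Incomp (e a) (e c) → T c b)

/-- The elements in the variables `2`, `3`, `4`. -/
def VarsAre (a b c : ℕ) (σ : ArrState) : Prop := σ.var 2 = a ∧ σ.var 3 = b ∧ σ.var 4 = c

theorem ArrExpr.fits_at {k x y : ℕ} {a b : Fin n} (hw : n + 1 < 2 ^ w) (hk : k < 4) (hx : x < 15)
    (hy : y < 15) (hxa : σ.var x = a) (hyb : σ.var y = b) : (ArrExpr.at k x y).Fits w n σ := by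
  have ha := a.2
  have hb := b.2
  simp only [ArrExpr.Fits, ArrExpr.eval, hxa, hyb]
  exact ⟨⟨hx, by omega⟩, ⟨hy, by omega⟩, hk, ha, hb⟩

theorem ArrExpr.fits_comparable {x y : ℕ} {a b : Fin n} (hw : n + 1 < 2 ^ w)
    (ho : HoldsOrder e σ) (hx : x < 15) (hy : y < 15) (hxa : σ.var x = a) (hyb : σ.var y = b) :
    (ArrExpr.comparable x y).Fits w n σ := by
  have ha := a.2
  have h1 := ho.le_one a b
  have h2 := ho.le_one b a
  refine ⟨fits_at hw (by omega) hx hy hxa hyb, fits_at hw (by omega) hy hx hyb hxa, ?_⟩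
  simp only [RamOp.eval, ArrExpr.eval, hxa, hyb]
  omega

theorem ArrExpr.eval_at {k x y : ℕ} {a b : ℕ} (hxa : σ.var x = a) (hyb : σ.var y = b) :
    (ArrExpr.at k x y).eval σ = σ.arr k a b := by
  simp only [ArrExpr.eval, hxa, hyb]

theorem ArrExpr.eval_comparable {x y : ℕ} {a b : ℕ} (hxa : σ.var x = a) (hyb : σ.var y = b) :
    (ArrExpr.comparable x y).eval σ = σ.arr 0 a b + σ.arr 0 b a := by
  simp only [ArrExpr.eval, RamOp.eval, hxa, hyb]

/-- Marking a pair that is forced. -/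
theorem OrientInv.wp_mark (h : OrientInv e T X σ) {x y : ℕ} {a b i j k : Fin n}
    (hw : n + 1 < 2 ^ w) (hx : x < 15) (hy : y < 15) (hxa : σ.var x = a) (hyb : σ.var y = b)
    (hv : VarsAre i j k σ)
    (hQ : ∀ Q : α → α → Prop, IsConjugateOrder Q →
      (∀ a b : Fin n, σ.arr 1 a b ≠ 0 → Q (e a) (e b)) → Q (e a) (e b))
    (hXY : T a b → X → Y) (hij : σ.arr 1 i j ≠ 0) :
    (ArrStmt.mark x y).wp w n
      (fun σ => OrientInv e T Y σ ∧ VarsAre i j k σ ∧ σ.arr 1 i j ≠ 0) σ := by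
  refine ArrStmt.wp_mark hw hx hy hxa hyb (fun h1 => ⟨h.congr fun h5 => hXY (h.eq h5 _ _ h1), hv,
    hij⟩) (fun h0 => ?_)
  obtain ⟨Q, hQc, hle⟩ := h.conj
  refine ⟨h.mark h0 ⟨Q, hQc, hle, hQ Q hQc hle⟩, hv, ?_⟩
  simp only [ArrState.setVar_arr, ArrState.setArr_arr]
  split_ifs
  · omega
  · exact hij

theorem OrientInv.wp_propagateAt (h : OrientInv e T X σ) (hw : n + 1 < 2 ^ w) {a b c : Fin n}
    (hv : VarsAre a b c σ) :
    ArrStmt.propagateAt.wp w n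
      (fun σ => OrientInv e T (X ∧ PropagatedAt e T a b c) σ ∧ VarsAre a b c σ) σ := by
  refine ⟨ArrExpr.fits_at hw (by omega) (by omega) (by omega) hv.1 hv.2.1, fun hab => ?_,
    fun hab => ?_⟩
  swap
  · rw [ArrExpr.eval_at hv.1 hv.2.1] at hab
    exact ⟨h.congr fun h5 hX => ⟨hX, fun hT => absurd hab (h.mono _ _ hT)⟩, hv⟩
  rw [ArrExpr.eval_at hv.1 hv.2.1] at hab
  have first : (ArrStmt.ite (.at 1 3 4) (.mark 2 4) .skip).wp w n (fun σ =>
      OrientInv e T (X ∧ (T b c → T a c)) σ ∧ VarsAre a b c σ ∧ σ.arr 1 a b ≠ 0) σ := by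
    refine ⟨ArrExpr.fits_at hw (by omega) (by omega) (by omega) hv.2.1 hv.2.2, fun hbc => ?_,
      fun hbc => ?_⟩
    · rw [ArrExpr.eval_at hv.2.1 hv.2.2] at hbc
      exact h.wp_mark hw (by omega) (by omega) hv.1 hv.2.2 hv
        (fun Q hQ hle => hQ.trans (hle _ _ hab) (hle _ _ hbc)) (fun hac hX => ⟨hX, fun _ => hac⟩)
        hab
    · rw [ArrExpr.eval_at hv.2.1 hv.2.2] at hbc
      exact ⟨h.congr fun h5 hX => ⟨hX, fun hT => absurd hbc (h.mono _ _ hT)⟩, hv, hab⟩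
  refine ArrStmt.wp_seq first (fun σ hσ => ?_)
  clear first h hv hab
  obtain ⟨h, hv, hab⟩ := hσ
  have eac := ArrExpr.eval_comparable hv.1 hv.2.2
  have ebc := ArrExpr.eval_comparable hv.2.1 hv.2.2
  have iac := h.order.comparable_eq_zero a c
  have ibc := h.order.comparable_eq_zero b c
  refine ⟨ArrExpr.fits_comparable hw h.order (by omega) (by omega) hv.1 hv.2.2, fun hac => ?_,
    fun hac => ?_⟩
  · rw [eac, Ne, iac] at hac
    refine ⟨ArrExpr.fits_comparable hw h.order (by omega) (by omega) hv.2.1 hv.2.2, fun hbc => ?_,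
      fun hbc => ?_⟩
    · rw [ebc, Ne, ibc] at hbc
      exact ⟨h.congr fun h5 hX => ⟨hX.1, fun _ => ⟨hX.2, fun h => absurd h hac,
        fun h => absurd h hbc⟩⟩, hv⟩
    · rw [ebc, ibc] at hbc
      refine ArrStmt.wp_mono _ (fun σ hσ => ⟨hσ.1, hσ.2.1⟩) (h.wp_mark hw (by omega) (by omega)
        hv.2.2 hv.2.1 hv (fun Q hQ hle => hQ.right_of_left (hle _ _ hab) hbc.symm hac)
        (fun hT hX => ⟨hX.1, fun _ => ⟨hX.2, fun h => absurd h hac, fun _ _ => hT⟩⟩) hab)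
  · rw [eac, iac] at hac
    refine ⟨ArrExpr.fits_comparable hw h.order (by omega) (by omega) hv.2.1 hv.2.2, fun hbc => ?_,
      fun hbc => ?_⟩
    · rw [ebc, Ne, ibc] at hbc
      refine ArrStmt.wp_mono _ (fun σ hσ => ⟨hσ.1, hσ.2.1⟩) (h.wp_mark hw (by omega) (by omega)
        hv.1 hv.2.2 hv (fun Q hQ hle => hQ.left_of_right (hle _ _ hab) hac hbc)
        (fun hT hX => ⟨hX.1, fun _ => ⟨hX.2, fun _ _ => hT, fun h => absurd h hbc⟩⟩) hab)
    · rw [ebc, ibc] at hbc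
      exact ⟨h.congr fun h5 hX => ⟨hX.1, fun _ => ⟨hX.2, fun _ h => absurd hbc h,
        fun _ h => absurd hac h⟩⟩, hv⟩

theorem OrientInv.wp_propagate (h : OrientInv e T X σ) (hw : n + 1 < 2 ^ w) :
    ArrStmt.propagate.wp w n
      (fun σ => OrientInv e T (X ∧ ∀ a b c, PropagatedAt e T a b c) σ) σ := by
  refine ArrStmt.wp_loop (fun k σ => OrientInv e T
    (X ∧ ∀ a b c : Fin n, k ≤ a.1 → PropagatedAt e T a b c) σ) (by omega)
    (h.congr fun _ hX => ⟨hX, fun a _ _ h => absurd h (by omega)⟩) (fun a σ h => ?_)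
    (fun σ h => h.congr fun _ hX => ⟨hX.1, fun a b c => hX.2 a b c (Nat.zero_le _)⟩)
  refine ArrStmt.wp_loop (fun k σ => OrientInv e T
    ((X ∧ ∀ a' b c : Fin n, a.1 + 1 ≤ a'.1 → PropagatedAt e T a' b c) ∧
      ∀ b c : Fin n, k ≤ b.1 → PropagatedAt e T a b c) σ ∧ σ.var 2 = a) (by omega)
    ⟨(h.setVar (by omega)).congr fun _ hX => ⟨hX, fun b _ h => absurd h (by omega)⟩, by simp⟩
    (fun b σ h => ?_) (fun σ h => h.1.congr fun _ hX => ⟨hX.1.1, fun a' b c ha' => ?_⟩)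
  · refine ArrStmt.wp_loop (fun k σ => OrientInv e T
      (((X ∧ ∀ a' b c : Fin n, a.1 + 1 ≤ a'.1 → PropagatedAt e T a' b c) ∧
        ∀ b' c : Fin n, b.1 + 1 ≤ b'.1 → PropagatedAt e T a b' c) ∧
        ∀ c : Fin n, k ≤ c.1 → PropagatedAt e T a b c) σ ∧ σ.var 2 = a ∧ σ.var 3 = b) (by omega)
      ⟨(h.1.setVar (by omega)).congr fun _ hX => ⟨hX, fun c h => absurd h (by omega)⟩,
        by simp [h.2], by simp⟩
      (fun c σ h => ?_)
      (fun σ h => ⟨h.1.congr fun _ hX => ⟨hX.1.1, fun b' c hb' => ?_⟩, h.2.1⟩)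
    · refine ArrStmt.wp_mono _ (fun σ h => ⟨h.1.congr fun _ hX => ⟨hX.1.1, fun c' hc' => ?_⟩,
        h.2.1, h.2.2.1⟩) ((h.1.setVar (by omega)).wp_propagateAt hw (a := a) (b := b) (c := c)
          ⟨by simp [h.2.1], by simp [h.2.2], by simp⟩)
      by_cases hcc : c = c'
      · exact hcc ▸ hX.2
      · exact hX.1.2 c' (Nat.lt_of_le_of_ne hc' fun h => hcc (Fin.ext h))
    · by_cases hbb : b = b'
      · exact hbb ▸ hX.2 c (Nat.zero_le _)
      · exact hX.1.2 b' c (Nat.lt_of_le_of_ne hb' fun h => hbb (Fin.ext h))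
  · by_cases haa : a = a'
    · exact haa ▸ hX.2 b c (Nat.zero_le _)
    · exact hX.1.2 a' b c (Nat.lt_of_le_of_ne ha' fun h => haa (Fin.ext h))

/-- A flag that is still down means that array `1` equals `T` and that `T` is closed under the
rules. Then an undecided pair can be oriented freely, within a conjugate order that may differ from
the previous one. -/
theorem OrientInv.wp_chooseAt [Finite α] (h : OrientInv e T X σ)
    (hX : X → ∀ a b c, PropagatedAt e T a b c) (hw : n + 1 < 2 ^ w) {a b : Fin n}
    (hva : σ.var 2 = a) (hvb : σ.var 3 = b) :
    ArrStmt.chooseAt.wp w n (fun σ => OrientInv e T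
      (X ∧ (Incomp (e a) (e b) → T a b ∨ T b a)) σ ∧ σ.var 2 = a) σ := by
  have hfl := h.flag_le_one
  refine ⟨⟨by omega, by omega⟩, fun h5 => ⟨h.congr fun h5' => absurd h5' h5, hva⟩, fun h5 => ?_⟩
  refine ⟨ArrExpr.fits_comparable hw h.order (by omega) (by omega) hva hvb, fun hab => ?_,
    fun hab => ?_⟩
  · rw [ArrExpr.eval_comparable hva hvb, Ne, h.order.comparable_eq_zero] at hab
    exact ⟨h.congr fun h5 hX => ⟨hX, fun h => absurd h hab⟩, hva⟩
  rw [ArrExpr.eval_comparable hva hvb, h.order.comparable_eq_zero] at hab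
  refine ⟨ArrExpr.fits_at hw (by omega) (by omega) (by omega) hvb hva, fun hba => ?_,
    fun hba => ?_⟩
  · rw [ArrExpr.eval_at hvb hva] at hba
    exact ⟨h.congr fun h5 hX => ⟨hX, fun _ => Or.inr (h.eq h5 _ _ hba)⟩, hva⟩
  rw [ArrExpr.eval_at hvb hva] at hba
  refine ArrStmt.wp_mark hw (by omega) (by omega) hva hvb
    (fun h1 => ⟨h.congr fun h5 hX => ⟨hX, fun _ => Or.inl (h.eq h5 _ _ h1)⟩, hva⟩)
    (fun h0 => ⟨h.mark h0 ?_, hva⟩)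
  obtain ⟨Q, hQ, hle⟩ := h.conj
  have hcl := hX (h.holds h5)
  have hT : ∀ x y, T (e.symm x) (e.symm y) → Q x y := fun x y hxy => by
    simpa using hle _ _ (h.mono _ _ hxy)
  obtain ⟨Q', hQ', hle', hab'⟩ := hQ.exists_extension
    (T := fun x y => T (e.symm x) (e.symm y)) hT
    (fun x y z hxy => (hcl _ _ _ hxy).1)
    (fun x y z hxy => by simpa using (hcl _ _ (e.symm z) hxy).2.1)
    (fun x y z hxy => by simpa using (hcl _ _ (e.symm z) hxy).2.2) hab
    (by simpa using fun hT => h.mono _ _ hT h0) (by simpa using fun hT => h.mono _ _ hT hba)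
  exact ⟨Q', hQ', fun x y hxy => hle' _ _ (by simpa using h.eq h5 _ _ hxy), hab'⟩

theorem OrientInv.wp_choose [Finite α] (h : OrientInv e T X σ)
    (hX : X → ∀ a b c, PropagatedAt e T a b c) (hw : n + 1 < 2 ^ w) :
    ArrStmt.choose.wp w n (fun σ => OrientInv e T
      (X ∧ ∀ a b, Incomp (e a) (e b) → T a b ∨ T b a) σ) σ := by
  refine ArrStmt.wp_loop (fun k σ => OrientInv e T
    (X ∧ ∀ a b : Fin n, k ≤ a.1 → Incomp (e a) (e b) → T a b ∨ T b a) σ) (by omega)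
    (h.congr fun _ hX => ⟨hX, fun a _ h => absurd h (by omega)⟩) (fun a σ h => ?_)
    (fun σ h => h.congr fun _ hX => ⟨hX.1, fun a b => hX.2 a b (Nat.zero_le _)⟩)
  refine ArrStmt.wp_loop (fun k σ => OrientInv e T
    ((X ∧ ∀ a' b : Fin n, a.1 + 1 ≤ a'.1 → Incomp (e a') (e b) → T a' b ∨ T b a') ∧
      ∀ b : Fin n, k ≤ b.1 → Incomp (e a) (e b) → T a b ∨ T b a) σ ∧ σ.var 2 = a) (by omega)
    ⟨(h.setVar (by omega)).congr fun _ hX => ⟨hX, fun b h => absurd h (by omega)⟩, by simp⟩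
    (fun b σ h => ?_) (fun σ h => h.1.congr fun _ hX => ⟨hX.1.1, fun a' b ha' => ?_⟩)
  · refine ArrStmt.wp_mono _ (fun σ h => ⟨h.1.congr fun _ hX => ⟨hX.1.1, fun b' hb' => ?_⟩, h.2⟩)
      ((h.1.setVar (i := 3) (v := b) (by omega)).wp_chooseAt (fun h => hX h.1.1) hw
        (a := a) (b := b) (by simp [h.2]) (by simp))
    by_cases hbb : b = b'
    · exact hbb ▸ hX.2
    · exact hX.1.2 b' (Nat.lt_of_le_of_ne hb' fun h => hbb (Fin.ext h))
  · by_cases haa : a = a'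
    · exact haa ▸ hX.2 b (Nat.zero_le _)
    · exact hX.1.2 a' b (Nat.lt_of_le_of_ne ha' fun h => haa (Fin.ext h))

/-- Array `1` is part of a conjugate order. -/
structure PartiallyOriented (e : Fin n ≃ α) (σ : ArrState) : Prop where
  order : HoldsOrder e σ
  le_one : ∀ a b : Fin n, σ.arr 1 a b ≤ 1
  conj : ∃ Q : α → α → Prop, IsConjugateOrder Q ∧ ∀ a b : Fin n, σ.arr 1 a b ≠ 0 → Q (e a) (e b)
  zero : ∀ k, 2 ≤ k → ∀ a b : Fin n, σ.arr k a b = 0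

theorem OrientInv.partiallyOriented (h : OrientInv e T X σ) : PartiallyOriented e σ :=
  ⟨h.order, h.le_one, h.conj, h.zero⟩

/-- Every incomparable pair is oriented by array `1`. -/
def Decided (e : Fin n ≃ α) (σ : ArrState) : Prop :=
  ∀ a b : Fin n, Incomp (e a) (e b) → σ.arr 1 a b ≠ 0 ∨ σ.arr 1 b a ≠ 0

/-- The number of pairs that are oriented by array `1`. -/
def orientedCard (n : ℕ) (σ : ArrState) : ℕ :=
  (Finset.univ.filter fun p : Fin n × Fin n => σ.arr 1 p.1 p.2 ≠ 0).card

/-- If the flag ends up raised, at least one pair is new; if not, the choice found no undecided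
pair. The number m bounds the pairs not yet oriented, hence the rounds still needed. -/
theorem PartiallyOriented.wp_orientStep [Finite α] (h : PartiallyOriented e σ) {m : ℕ}
    (hw : n + 1 < 2 ^ w) (hm : Decided e σ ∨ n * n ≤ orientedCard n σ + (m + 1)) :
    ArrStmt.orientStep.wp w n (fun σ => PartiallyOriented e σ ∧
      (Decided e σ ∨ n * n ≤ orientedCard n σ + m)) σ := by
  set T : Fin n → Fin n → Prop := fun a b => σ.arr 1 a b ≠ 0 with hT
  have h0 : OrientInv e T True (σ.setVar 5 0) :=
    { order := h.order
      le_one := h.le_one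
      conj := h.conj
      mono := fun a b h => h
      flag_le_one := by simp
      flag := by simp
      eq := fun _ a b h => h
      holds := fun _ => trivial
      zero := h.zero }
  refine ⟨by omega, by simp only [ArrExpr.Fits]; omega, by simp only [ArrExpr.eval]; omega, ?_⟩
  refine ArrStmt.wp_seq (h0.wp_propagate hw) (fun σ₁ h₁ => ?_)
  refine ArrStmt.wp_mono _ (fun σ₂ h₂ => ?_) (h₁.wp_choose (fun h => h.2) hw)
  refine ⟨h₂.partiallyOriented, ?_⟩
  by_cases h5 : σ₂.var 5 = 0
  · exact Or.inl fun a b hab => ((h₂.holds h5).2 a b hab).imp (h₂.mono a b) (h₂.mono b a)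
  · rcases hm with hm | hm
    · exact Or.inl fun a b hab => (hm a b hab).imp (h₂.mono a b) (h₂.mono b a)
    · right
      obtain ⟨a, b, hab, hTab⟩ := h₂.flag h5
      have : orientedCard n σ < orientedCard n σ₂ := by
        refine Finset.card_lt_card ((Finset.ssubset_iff_of_subset ?_).2 ⟨(a, b), ?_, ?_⟩)
        · exact Finset.monotone_filter_right _ fun p _ hp => h₂.mono _ _ hp
        · simp [hab]
        · simpa [hT] using hTab
      omega

theorem PartiallyOriented.setVar (h : PartiallyOriented e σ) (i v : ℕ) :
    PartiallyOriented e (σ.setVar i v) := ⟨h.order, h.le_one, h.conj, h.zero⟩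

/-- Array `1` holds a conjugate order. -/
structure Oriented (e : Fin n ≃ α) (Q : α → α → Prop) (σ : ArrState) : Prop where
  order : HoldsOrder e σ
  le_one : ∀ a b : Fin n, σ.arr 1 a b ≤ 1
  iff : ∀ a b : Fin n, σ.arr 1 a b ≠ 0 ↔ Q (e a) (e b)

theorem PartiallyOriented.wp_orient [Finite α] (h : PartiallyOriented e σ)
    (hw : n + 1 < 2 ^ w) :
    ArrStmt.orient.wp w n (fun σ => (∃ Q, IsConjugateOrder Q ∧ Oriented e Q σ) ∧
      ∀ k, 2 ≤ k → ∀ a b : Fin n, σ.arr k a b = 0) σ := by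
  -- The two outer loops serve only to run n · n rounds, as many as there are ordered pairs.
  refine ArrStmt.wp_loop (fun k σ => PartiallyOriented e σ ∧
      (Decided e σ ∨ n * n ≤ orientedCard n σ + k * n)) (by omega) ⟨h, Or.inr (by omega)⟩
    (fun a σ h => ?_) (fun σ h => ?_)
  · refine ArrStmt.wp_loop (fun k σ => PartiallyOriented e σ ∧
      (Decided e σ ∨ n * n ≤ orientedCard n σ + (a * n + k))) (by omega) ⟨h.1.setVar _ _, ?_⟩
      (fun b σ h => (h.1.setVar _ _).wp_orientStep hw h.2) (fun σ h => h)
    have := h.2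
    rwa [add_mul, one_mul] at this
  · obtain ⟨h, hdec⟩ := h
    have hdec : Decided e σ := by
      rcases hdec with hdec | hdec
      · exact hdec
      · intro a b _
        left
        have hfull : (Finset.univ.filter fun p : Fin n × Fin n => σ.arr 1 p.1 p.2 ≠ 0) =
            Finset.univ := by
          rw [← Finset.card_eq_iff_eq_univ]
          refine le_antisymm (Finset.card_le_univ _) ?_
          rw [Fintype.card_prod, Fintype.card_fin]
          simpa [orientedCard] using hdec
        have := Finset.mem_univ (a, b)
        rw [← hfull, Finset.mem_filter] at this
        exact this.2
    obtain ⟨Q, hQ, hle⟩ := h.conj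
    refine ⟨⟨Q, hQ, h.order, h.le_one, fun a b => ⟨hle a b, fun hab => ?_⟩⟩, h.zero⟩
    rcases hdec a b (hQ.incomp hab) with h' | h'
    · exact h'
    · exact absurd (hle _ _ h') (hQ.asymm hab)

end Orient

/-! ### Counting downsets and inversions -/

namespace ArrStmt

/-- Sum up in variable `6` the recursion for the number of downsets. -/
def sumCounts (k : ℕ) (r : ArrExpr) : ArrStmt :=
  .loop 3 (.ite r (.ite (.at 0 1 3) .skip (.set 6 (.op .add (.var 6) (.at k 3 1)))) .skip)

/-- Apply the recursion for the number of downsets to the elements in the variables `2` and `1`. -/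
def updateCount (k : ℕ) (r : ArrExpr) : ArrStmt :=
  .seq (.set 6 (.lit 1)) (.seq (sumCounts k r) (.put k (.var 2) (.var 1) (.var 6)))

/-- Compute in array `k` the numbers of downsets for the relation that is given by the expression
`r` in the variables `2` and `3`. -/
def countDownsets (k : ℕ) (r : ArrExpr) : ArrStmt :=
  .loop 0 (.loop 1 (.loop 2 (updateCount k r)))

/-- Compute the number of inversions in variable `6`. -/
def sumInversions : ArrStmt :=
  .seq (.set 6 (.lit 0)) (.loop 2 (.loop 3 (.ite (.at 1 2 3)
    (.set 6 (.op .add (.var 6) (.op .mul (.at 2 2 3) (.at 3 3 2)))) .skip)))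

/-- Compute the linear extension diameter of the downset lattice in variable `6`. -/
def ledProgram : ArrStmt :=
  .seq orient (.seq (countDownsets 2 (.at 1 2 3)) (.seq (countDownsets 3 (.at 1 3 2))
    sumInversions))

end ArrStmt

theorem Fin.sum_filter_le_eq_add {n : ℕ} (f : Fin n → ℕ) (k : Fin n) :
    ∑ z with k.1 ≤ z.1, f z = ∑ z with k.1 + 1 ≤ z.1, f z + f k := by
  have h : (Finset.univ.filter fun z : Fin n => k.1 ≤ z.1) =
      insert k (Finset.univ.filter fun z : Fin n => k.1 + 1 ≤ z.1) := by
    ext z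
    simp only [Finset.mem_filter, Finset.mem_univ, true_and, Finset.mem_insert, Fin.ext_iff]
    omega
  rw [h, Finset.sum_insert (by simp), add_comm]

theorem Fin.sum_filter_card_le {n : ℕ} (f : Fin n → ℕ) : ∑ z with n ≤ z.1, f z = 0 :=
  Finset.sum_eq_zero fun z hz => by
    rw [Finset.mem_filter] at hz
    omega

/-! ### Correctness of the counting loops -/

section Count

variable {α : Type*} [PartialOrder α] {n : ℕ} {e : Fin n ≃ α}

open Classical in
theorem downsetCount_eq_sum_fin {R : α → α → Prop} (hR : IsConjugateOrder R) (e : Fin n ≃ α)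
    (x m : Fin n) : downsetCount R (e x) (e m) =
      1 + ∑ z, if R (e x) (e z) ∧ ¬ e m ≤ e z then downsetCount R (e z) (e m) else 0 := by
  have := Fintype.ofEquiv _ e
  rw [hR.downsetCount_eq, ← e.sum_comp]
  exact congrArg (1 + ·) (Finset.sum_congr rfl fun z _ => if_congr Iff.rfl rfl rfl)

theorem downsetCount_le_two_pow (R : α → α → Prop) (e : Fin n ≃ α) (x m : α) :
    downsetCount R x m ≤ 2 ^ n := by
  have := Fintype.ofEquiv _ e
  refine (IsConjugateOrder.downsetCount_le R x m).trans ?_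
  rw [← Fintype.card_congr e, Fintype.card_fin]

/-- The number of elements to the right of `x`. -/
noncomputable def rightCard (R : α → α → Prop) (x : α) : ℕ := {z | R x z}.ncard

/-- The rank along which the recursion for the numbers of downsets descends. -/
theorem IsConjugateOrder.rightCard_lt [Finite α] {R : α → α → Prop} (hR : IsConjugateOrder R)
    {x z : α} (h : R x z) : rightCard R z < rightCard R x :=
  Set.ncard_lt_ncard ((Set.ssubset_iff_of_subset fun _ hy => hR.trans h hy).2
    ⟨z, h, hR.irrefl z⟩) (Set.toFinite _)

theorem IsConjugateOrder.rightCard_lt_card {R : α → α → Prop} (hR : IsConjugateOrder R)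
    (e : Fin n ≃ α) (x : α) : rightCard R x < n := by
  have := Finite.of_equiv _ e
  calc rightCard R x < (Set.univ : Set α).ncard :=
        Set.ncard_lt_ncard ((Set.ssubset_iff_of_subset (Set.subset_univ _)).2
          ⟨x, Set.mem_univ _, hR.irrefl x⟩) (Set.toFinite _)
    _ = n := by rw [Set.ncard_univ, ← Nat.card_congr e, Nat.card_fin]

/-- The expression `r` decides the relation `R`. -/
def Decides (e : Fin n ≃ α) (w : ℕ) (R : α → α → Prop) (r : ArrExpr) (σ : ArrState) : Prop :=
  ∀ (σ' : ArrState) (x z : Fin n), (∀ a b : Fin n, σ'.arr 1 a b = σ.arr 1 a b) →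
    σ'.var 2 = x → σ'.var 3 = z → r.Fits w n σ' ∧ (r.eval σ' ≠ 0 ↔ R (e x) (e z))

/-- Array `k` holds lower bounds for the numbers of downsets, which are exact where `S` holds; the
other arrays agree with those of `σ₀`. -/
structure CountInv (e : Fin n ≃ α) (k : ℕ) (R : α → α → Prop) (σ₀ : ArrState)
    (S : Fin n → Fin n → Prop) (σ : ArrState) : Prop where
  other : ∀ k', k' ≠ k → σ.arr k' = σ₀.arr k'
  le : ∀ x m : Fin n, σ.arr k x m ≤ downsetCount R (e x) (e m)
  eq : ∀ x m : Fin n, S x m → σ.arr k x m = downsetCount R (e x) (e m)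

variable {k w : ℕ} {R : α → α → Prop} {r : ArrExpr} {σ₀ σ : ArrState}
  {S S' : Fin n → Fin n → Prop}

theorem CountInv.congr (h : CountInv e k R σ₀ S σ) (hS : ∀ x m, S' x m → S x m) :
    CountInv e k R σ₀ S' σ := ⟨h.other, h.le, fun x m hxm => h.eq x m (hS x m hxm)⟩

theorem CountInv.setVar (h : CountInv e k R σ₀ S σ) (i v : ℕ) :
    CountInv e k R σ₀ S (σ.setVar i v) := ⟨h.other, h.le, h.eq⟩

open Classical in
-- Entries not yet exact are still lower bounds, so by the recursion no partial sum exceeds a true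
-- count and nothing overflows.
theorem CountInv.wp_sumCounts (h : CountInv e k R σ₀ S σ) (hR : IsConjugateOrder R)
    (ho : HoldsOrder e σ₀) (hr : Decides e w R r σ₀) (hw : n + 1 < 2 ^ w) (hw' : 2 ^ n < 2 ^ w)
    (hk1 : 1 < k) (hk4 : k < 4) {x m : Fin n} (hm : σ.var 1 = m) (hx : σ.var 2 = x)
    (h6 : σ.var 6 = 1) :
    (ArrStmt.sumCounts k r).wp w n (fun σ' => σ'.arr = σ.arr ∧ σ'.var 1 = m ∧ σ'.var 2 = x ∧
      σ'.var 6 = 1 + ∑ z : Fin n, if R (e x) (e z) ∧ ¬ e m ≤ e z then σ.arr k z m else 0) σ := by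
  set f : Fin n → ℕ := fun z => if R (e x) (e z) ∧ ¬ e m ≤ e z then σ.arr k z m else 0 with hf
  have hbound : 1 + ∑ z, f z < 2 ^ w := by
    refine lt_of_le_of_lt ?_ hw'
    refine le_trans ?_ (downsetCount_le_two_pow R e (e x) (e m))
    rw [downsetCount_eq_sum_fin hR]
    refine Nat.add_le_add_left (Finset.sum_le_sum fun z _ => ?_) 1
    simp only [hf]
    split_ifs
    · exact h.le z m
    · exact le_rfl
  refine ArrStmt.wp_loop (fun j σ' => σ'.arr = σ.arr ∧ σ'.var 1 = m ∧ σ'.var 2 = x ∧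
    σ'.var 6 = 1 + ∑ z with j ≤ z.1, f z) (by omega) ⟨rfl, hm, hx, ?_⟩ (fun z σ' h' => ?_)
    (fun σ' h' => ⟨h'.1, h'.2.1, h'.2.2.1, by simpa using h'.2.2.2⟩)
  · rw [h6, Fin.sum_filter_card_le]
  · obtain ⟨harr, hm, hx, h6⟩ := h'
    have harr' : (σ'.setVar 3 z).arr = σ.arr := harr
    have hm' : (σ'.setVar 3 z).var 1 = m := hm
    have hx' : (σ'.setVar 3 z).var 2 = x := hx
    have hz' : (σ'.setVar 3 z).var 3 = z := by simp
    have h6' : (σ'.setVar 3 z).var 6 = 1 + ∑ z' with z.1 + 1 ≤ z'.1, f z' := h6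
    generalize σ'.setVar 3 z = τ at harr' hm' hx' hz' h6'
    clear harr hm hx h6 σ'
    have hsum := Fin.sum_filter_le_eq_add f z
    have hle : ∑ z' with z.1 ≤ z'.1, f z' ≤ ∑ z', f z' :=
      Finset.sum_le_sum_of_subset (Finset.filter_subset _ _)
    obtain ⟨hfit, hiff⟩ := hr τ x z (fun a b => by rw [harr', h.other 1 (by omega)]) hx' hz'
    have hmz : (ArrExpr.at 0 1 3).eval τ = if e m ≤ e z then 1 else 0 := by
      rw [ArrExpr.eval_at hm' hz', harr', h.other 0 (by omega), ho m z]
    have hkz : (ArrExpr.at k 3 1).eval τ = σ.arr k z m := by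
      rw [ArrExpr.eval_at hz' hm', harr']
    refine ⟨hfit, fun h0 => ⟨ArrExpr.fits_at hw (by omega) (by omega) (by omega) hm' hz',
      fun h1 => ?_, fun h1 => ?_⟩, fun h0 => ?_⟩
    · have : e m ≤ e z := by
        by_contra hn
        rw [hmz, if_neg hn] at h1
        exact h1 rfl
      have hfz : f z = 0 := by simp [hf, this]
      exact ⟨harr', hm', hx', by omega⟩
    · have : ¬ e m ≤ e z := by
        intro hn
        rw [hmz, if_pos hn] at h1
        omega
      have hfz : f z = σ.arr k z m := by simp [hf, this, hiff.1 h0]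
      have hv : (ArrExpr.op .add (.var 6) (.at k 3 1)).eval τ = 1 + ∑ z' with z.1 ≤ z'.1, f z' := by
        rw [ArrExpr.eval, RamOp.eval, hkz, ArrExpr.eval, h6', hsum, hfz]
        omega
      refine ⟨by omega, ⟨⟨by omega, by omega⟩, ArrExpr.fits_at hw hk4 (by omega) (by omega) hz' hm',
        ?_⟩, ?_, harr', hm', hx', ?_⟩
      · change (ArrExpr.op .add (.var 6) (.at k 3 1)).eval τ < 2 ^ w
        omega
      · omega
      · rw [hv]
        simp
    · have : ¬ R (e x) (e z) := fun hn => hiff.2 hn h0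
      have hfz : f z = 0 := by simp [hf, this]
      exact ⟨harr', hm', hx', by omega⟩

/-- The updated entry becomes exact as soon as all entries to the right of x in the same column are.
-/
theorem CountInv.wp_updateCount (h : CountInv e k R σ₀ S σ) (hR : IsConjugateOrder R)
    (ho : HoldsOrder e σ₀) (hr : Decides e w R r σ₀) (hw : n + 1 < 2 ^ w) (hw' : 2 ^ n < 2 ^ w)
    (hk1 : 1 < k) (hk4 : k < 4) {x m : Fin n} (hm : σ.var 1 = m) (hx : σ.var 2 = x)
    (hS : ∀ x' m', S' x' m' → (x' = x ∧ m' = m) ∨ S x' m')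
    (hSx : S' x m → ∀ z, R (e x) (e z) → S z m) :
    (ArrStmt.updateCount k r).wp w n
      (fun σ => CountInv e k R σ₀ S' σ ∧ σ.var 1 = m) σ := by
  classical
  refine ⟨by omega, by simp only [ArrExpr.Fits]; omega, by simp only [ArrExpr.eval]; omega, ?_⟩
  refine ArrStmt.wp_seq ((h.setVar 6 1).wp_sumCounts hR ho hr hw hw' hk1 hk4 (x := x) (m := m)
    (by simpa using hm) (by simpa using hx) (by simp)) (fun τ hτ => ?_)
  obtain ⟨harr, hm', hx', h6⟩ := hτ
  rw [ArrState.setVar_arr] at harr h6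
  have hle : τ.var 6 ≤ downsetCount R (e x) (e m) := by
    rw [h6, downsetCount_eq_sum_fin hR]
    refine Nat.add_le_add_left (Finset.sum_le_sum fun z _ => ?_) 1
    split_ifs
    · exact h.le z m
    · exact le_rfl
  have heq : S' x m → τ.var 6 = downsetCount R (e x) (e m) := by
    intro hs
    rw [h6, downsetCount_eq_sum_fin hR]
    congr 1
    refine Finset.sum_congr rfl fun z _ => ?_
    split_ifs with hc
    · exact h.eq z m (hSx hs z hc.1)
    · rfl
  have h2 := downsetCount_le_two_pow R e (e x) (e m)
  have hxn := x.2
  have hmn := m.2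
  refine ⟨hk4, ⟨by omega, by omega⟩, ⟨by omega, by omega⟩, ⟨by omega, by omega⟩, ?_, ?_, ?_, hm'⟩
  · simp only [ArrExpr.eval]
    omega
  · simp only [ArrExpr.eval]
    omega
  · simp only [ArrExpr.eval, hx', hm']
    constructor
    · intro k' hk'
      rw [← h.other k' hk', ← harr]
      funext a b
      simp [hk']
    · intro x' m'
      simp only [ArrState.setArr_arr, harr]
      split_ifs with hc
      · obtain ⟨-, h1, h2⟩ := hc
        rw [Fin.ext h1, Fin.ext h2]
        exact hle
      · exact h.le x' m'
    · intro x' m' hs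
      simp only [ArrState.setArr_arr, harr]
      split_ifs with hc
      · obtain ⟨-, h1, h2⟩ := hc
        rw [Fin.ext h1, Fin.ext h2] at hs ⊢
        exact heq hs
      · rcases hS x' m' hs with ⟨rfl, rfl⟩ | hs'
        · exact absurd ⟨trivial, rfl, rfl⟩ hc
        · exact h.eq x' m' hs'

theorem wp_countDownsets (hR : IsConjugateOrder R) (ho : HoldsOrder e σ)
    (hr : Decides e w R r σ) (hw : n + 1 < 2 ^ w) (hw' : 2 ^ n < 2 ^ w) (hk1 : 1 < k)
    (hk4 : k < 4) (h0 : ∀ a b : Fin n, σ.arr k a b = 0) :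
    (ArrStmt.countDownsets k r).wp w n (fun σ' => (∀ k', k' ≠ k → σ'.arr k' = σ.arr k') ∧
      ∀ x m : Fin n, σ'.arr k x m = downsetCount R (e x) (e m)) σ := by
  have := Finite.of_equiv _ e
  -- The elements are listed in arbitrary order, so the whole table is swept n times in place. With
  -- j sweeps left, the entries of rank below n - j are exact, and every rank is below n.
  refine ArrStmt.wp_loop (fun j σ' => CountInv e k R σ (fun x _ => rightCard R (e x) + j < n) σ')
    (by omega) ⟨fun _ _ => rfl, fun x m => by simp [h0], fun x m h => by omega⟩
    (fun j σ₁ h₁ => ?_) (fun σ' h => ⟨h.other, fun x m => h.eq x m (by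
      simpa using hR.rightCard_lt_card e (e x))⟩)
  refine ArrStmt.wp_loop (fun i σ' => CountInv e k R σ (fun x m =>
    rightCard R (e x) + (j + 1) < n ∨ (rightCard R (e x) + j < n ∧ i ≤ m.1)) σ') (by omega)
    ((h₁.setVar _ _).congr fun x m h => h.resolve_right fun h => by omega)
    (fun m σ₂ h₂ => ?_) (fun σ' h => h.congr fun x m h => Or.inr ⟨h, Nat.zero_le _⟩)
  refine ArrStmt.wp_loop (fun i σ' => CountInv e k R σ (fun x m' =>
    rightCard R (e x) + (j + 1) < n ∨
      (rightCard R (e x) + j < n ∧ (m.1 + 1 ≤ m'.1 ∨ (m' = m ∧ i ≤ x.1)))) σ' ∧ σ'.var 1 = m)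
    (by omega) ⟨(h₂.setVar _ _).congr fun x m' h => ?_, by simp⟩ (fun x σ₃ h₃ => ?_)
    (fun σ' h => h.1.congr fun x m' h => ?_)
  · rcases h with h | ⟨h, h' | h'⟩
    · exact Or.inl h
    · exact Or.inr ⟨h, h'⟩
    · omega
  · refine (h₃.1.setVar _ _).wp_updateCount hR ho hr hw hw' hk1 hk4 (x := x) (m := m)
      (by simp [h₃.2]) (by simp) (fun x' m' h => ?_) (fun h z hz => ?_)
    · rcases h with h | ⟨h, h' | ⟨h1, h2⟩⟩
      · exact Or.inr (Or.inl h)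
      · exact Or.inr (Or.inr ⟨h, Or.inl h'⟩)
      · by_cases hxx : x' = x
        · exact Or.inl ⟨hxx, h1⟩
        · exact Or.inr (Or.inr ⟨h, Or.inr ⟨h1, Nat.lt_of_le_of_ne h2 fun h =>
            hxx (Fin.ext h.symm)⟩⟩)
    · have hlt := hR.rightCard_lt hz
      left
      rcases h with h | ⟨h, -⟩ <;> omega
  · rcases h with h | ⟨h, h'⟩
    · exact Or.inl h
    · by_cases hmm : m' = m
      · exact Or.inr ⟨h, Or.inr ⟨hmm, Nat.zero_le _⟩⟩
      · exact Or.inr ⟨h, Or.inl (Nat.lt_of_le_of_ne h' fun h => hmm (Fin.ext h.symm))⟩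

theorem Oriented.decides {Q : α → α → Prop} (h : Oriented e Q σ) (hw : n + 1 < 2 ^ w) :
    Decides e w Q (.at 1 2 3) σ := by
  intro σ' x z harr hx hz
  refine ⟨ArrExpr.fits_at hw (by omega) (by omega) (by omega) hx hz, ?_⟩
  rw [ArrExpr.eval_at hx hz, harr, h.iff]

theorem Oriented.decides_flip {Q : α → α → Prop} (h : Oriented e Q σ) (hw : n + 1 < 2 ^ w) :
    Decides e w (flip Q) (.at 1 3 2) σ := by
  intro σ' x z harr hx hz
  refine ⟨ArrExpr.fits_at hw (by omega) (by omega) (by omega) hz hx, ?_⟩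
  rw [ArrExpr.eval_at hz hx, harr, h.iff]
  rfl

theorem Oriented.congr {Q : α → α → Prop} (h : Oriented e Q σ) {σ' : ArrState}
    (h0 : σ'.arr 0 = σ.arr 0) (h1 : σ'.arr 1 = σ.arr 1) : Oriented e Q σ' :=
  ⟨fun a b => by rw [h0, h.order], fun a b => by rw [h1]; exact h.le_one a b,
    fun a b => by rw [h1]; exact h.iff a b⟩

open Classical in
theorem Oriented.wp_sumInversions {Q : α → α → Prop} (h : Oriented e Q σ)
    (h2 : ∀ x m : Fin n, σ.arr 2 x m = downsetCount Q (e x) (e m))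
    (h3 : ∀ x m : Fin n, σ.arr 3 x m = downsetCount (flip Q) (e x) (e m)) (hw : n + 1 < 2 ^ w)
    (hw' : n * (n * (2 ^ n * 2 ^ n)) < 2 ^ w) :
    ArrStmt.sumInversions.wp w n (fun σ => (σ.var 6 = ∑ x : Fin n, ∑ y : Fin n,
      if Q (e x) (e y) then downsetCount Q (e x) (e y) * downsetCount (flip Q) (e y) (e x)
        else 0) ∧ σ.var 6 < 2 ^ w) σ := by
  set f : Fin n → Fin n → ℕ := fun x y => if Q (e x) (e y) then
    downsetCount Q (e x) (e y) * downsetCount (flip Q) (e y) (e x) else 0 with hf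
  have hfle : ∀ x y, downsetCount Q (e x) (e y) * downsetCount (flip Q) (e y) (e x) ≤
      2 ^ n * 2 ^ n := fun x y =>
    Nat.mul_le_mul (downsetCount_le_two_pow _ e _ _) (downsetCount_le_two_pow _ e _ _)
  have hfle' : ∀ x y, f x y ≤ 2 ^ n * 2 ^ n := fun x y => by
    simp only [hf]
    split_ifs
    · exact hfle x y
    · exact Nat.zero_le _
  have hbound : ∑ x, ∑ y, f x y < 2 ^ w := by
    refine lt_of_le_of_lt ?_ hw'
    calc ∑ x, ∑ y, f x y ≤ ∑ x : Fin n, ∑ y : Fin n, 2 ^ n * 2 ^ n :=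
          Finset.sum_le_sum fun x _ => Finset.sum_le_sum fun y _ => hfle' x y
      _ = _ := by simp
  refine ⟨by omega, by simp only [ArrExpr.Fits]; omega, by simp only [ArrExpr.eval]; omega, ?_⟩
  refine ArrStmt.wp_loop (fun i σ' => σ'.arr = σ.arr ∧
    σ'.var 6 = ∑ x with i ≤ x.1, ∑ y, f x y) (by omega) ⟨rfl, ?_⟩ (fun x σ₁ h₁ => ?_)
    (fun σ' h' => ?_)
  rotate_left 2
  · have h6 : σ'.var 6 = ∑ x, ∑ y, f x y := by simpa using h'.2
    exact ⟨h6, by omega⟩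
  · simp only [ArrExpr.eval, ArrState.setVar_var, if_true]
    rw [Fin.sum_filter_card_le]
  have hsumx := Fin.sum_filter_le_eq_add (fun x => ∑ y, f x y) x
  have hlex : ∑ x' with x.1 ≤ x'.1, ∑ y, f x' y ≤ ∑ x', ∑ y, f x' y :=
    Finset.sum_le_sum_of_subset (Finset.filter_subset _ _)
  refine ArrStmt.wp_loop (fun i σ' => σ'.arr = σ.arr ∧ σ'.var 2 = x ∧
    σ'.var 6 = ∑ x' with x.1 + 1 ≤ x'.1, ∑ y, f x' y + ∑ y with i ≤ y.1, f x y) (by omega)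
    ⟨h₁.1, by simp, ?_⟩ (fun y σ₂ h₂ => ?_) (fun σ' h' => ⟨h'.1, ?_⟩)
  · rw [Fin.sum_filter_card_le]
    simpa using h₁.2
  · obtain ⟨harr, hx, h6⟩ := h₂
    have harr' : (σ₂.setVar 3 y).arr = σ.arr := harr
    have hx' : (σ₂.setVar 3 y).var 2 = x := hx
    have hy' : (σ₂.setVar 3 y).var 3 = y := by simp
    have h6' : (σ₂.setVar 3 y).var 6 =
      ∑ x' with x.1 + 1 ≤ x'.1, ∑ y, f x' y + ∑ y' with y.1 + 1 ≤ y'.1, f x y' := h6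
    generalize σ₂.setVar 3 y = τ at harr' hx' hy' h6'
    have hsumy := Fin.sum_filter_le_eq_add (f x) y
    have hley : ∑ y' with y.1 ≤ y'.1, f x y' ≤ ∑ y', f x y' :=
      Finset.sum_le_sum_of_subset (Finset.filter_subset _ _)
    refine ⟨ArrExpr.fits_at hw (by omega) (by omega) (by omega) hx' hy', fun h0 => ?_,
      fun h0 => ⟨harr', hx', ?_⟩⟩
    · rw [ArrExpr.eval_at hx' hy', harr', h.iff] at h0
      have hfxy : f x y = downsetCount Q (e x) (e y) * downsetCount (flip Q) (e y) (e x) := by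
        simp [hf, h0]
      have e2 : (ArrExpr.at 2 2 3).eval τ = downsetCount Q (e x) (e y) := by
        rw [ArrExpr.eval_at hx' hy', harr', h2]
      have e3 : (ArrExpr.at 3 3 2).eval τ = downsetCount (flip Q) (e y) (e x) := by
        rw [ArrExpr.eval_at hy' hx', harr', h3]
      have emul : (ArrExpr.op .mul (.at 2 2 3) (.at 3 3 2)).eval τ = f x y := by
        rw [ArrExpr.eval, RamOp.eval, e2, e3, hfxy]
      have eadd : (ArrExpr.op .add (.var 6) (.op .mul (.at 2 2 3) (.at 3 3 2))).eval τ =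
          ∑ x' with x.1 + 1 ≤ x'.1, ∑ y, f x' y + ∑ y' with y.1 ≤ y'.1, f x y' := by
        rw [ArrExpr.eval, RamOp.eval, emul, ArrExpr.eval, h6', hsumy]
        omega
      refine ⟨by omega, ⟨⟨by omega, by omega⟩, ⟨ArrExpr.fits_at hw (by omega) (by omega) (by omega)
        hx' hy', ArrExpr.fits_at hw (by omega) (by omega) (by omega) hy' hx', ?_⟩, ?_⟩, ?_,
        harr', hx', ?_⟩
      · change (ArrExpr.op .mul (.at 2 2 3) (.at 3 3 2)).eval τ < 2 ^ w
        omega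
      · change (ArrExpr.op .add (.var 6) (.op .mul (.at 2 2 3) (.at 3 3 2))).eval τ < 2 ^ w
        omega
      · omega
      · rw [eadd]
        simp
    · rw [ArrExpr.eval_at hx' hy', harr'] at h0
      have hfxy : f x y = 0 := by
        have : ¬ Q (e x) (e y) := fun hQ => (h.iff x y).2 hQ h0
        simp [hf, this]
      omega
  · rw [h'.2.2, hsumx]
    simp

theorem wp_ledProgram (h : PartiallyOriented e σ) (hw : n + 1 < 2 ^ w) (hw1 : 2 ^ n < 2 ^ w)
    (hw' : n * (n * (2 ^ n * 2 ^ n)) < 2 ^ w) :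
    ArrStmt.ledProgram.wp w n (fun σ => (σ.var 6 : ℕ∞) = led (LowerSet α) ∧ σ.var 6 < 2 ^ w) σ := by
  classical
  have := Fintype.ofEquiv _ e
  refine ArrStmt.wp_seq (h.wp_orient hw) (fun σ₁ h₁ => ?_)
  obtain ⟨⟨Q, hQ, ho₁⟩, hz₁⟩ := h₁
  refine ArrStmt.wp_seq (wp_countDownsets hQ ho₁.order (ho₁.decides hw) hw hw1
    (by omega) (by omega) (hz₁ 2 le_rfl)) (fun σ₂ h₂ => ?_)
  have ho₂ : Oriented e Q σ₂ := ho₁.congr (h₂.1 0 (by omega)) (h₂.1 1 (by omega))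
  refine ArrStmt.wp_seq (wp_countDownsets hQ.flip ho₂.order (ho₂.decides_flip hw) hw hw1
    (by omega) (by omega) (by rw [h₂.1 3 (by omega)]; exact hz₁ 3 (by omega))) (fun σ₃ h₃ => ?_)
  have ho₃ : Oriented e Q σ₃ := ho₂.congr (h₃.1 0 (by omega)) (h₃.1 1 (by omega))
  refine ArrStmt.wp_mono _ (fun σ₄ h₄ => ?_) (ho₃.wp_sumInversions
    (by rw [h₃.1 2 (by omega)]; exact h₂.2) h₃.2 hw hw')
  refine ⟨?_, h₄.2⟩
  rw [hQ.led_lowerSet_eq, hQ.ncard_inversions_colex, h₄.1, ← e.sum_comp]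
  simp_rw [← e.sum_comp (fun y => if Q _ y then _ else _)]

end Count

/-! ### The main theorem -/

/-- The machine program for the linear extension diameter of the downset lattice. -/
def ledMachine : RamProg :=
  .seq (ArrStmt.ledProgram.compile 16) (.seq (.const 16 0) (.op .add 0 7 16))

theorem isBigO_pow_of_le {T : ℕ → ℕ} {K d : ℕ} (h : ∀ n, T n ≤ K * (n + 1) ^ d) :
    (fun n : ℕ => (T n : ℝ)) =O[Filter.atTop] (fun n : ℕ => (n : ℝ) ^ d) := by
  refine Asymptotics.IsBigO.of_bound (K * 2 ^ d) ?_
  filter_upwards [Filter.eventually_ge_atTop 1] with n hn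
  have h1 : T n ≤ K * 2 ^ d * n ^ d := by
    refine (h n).trans ?_
    rw [mul_assoc, ← mul_pow]
    exact Nat.mul_le_mul_left K (Nat.pow_le_pow_left (by omega) d)
  rw [Real.norm_of_nonneg (by positivity), Real.norm_of_nonneg (by positivity)]
  exact_mod_cast h1

theorem mainTheorem7 :
    ∃ (p : RamProg) (c : ℕ) (T : ℕ → ℕ),
      (fun n : ℕ => (T n : ℝ)) =O[Filter.atTop] (fun n : ℕ => (n : ℝ) ^ 5) ∧
      ∀ (α : Type*) [PartialOrder α] (n : ℕ) (e : Fin n ≃ α), IsTwoDimensional α →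
        ∃ (t : ℕ) (s : RamState), t ≤ T n ∧
          p.Exec (c * (n + 1)) (posetInput e) t s ∧
          (s.reg 0 : ℕ∞) = led (LowerSet α) := by
  -- The factor 4 gives 2 ^ w = 16 · 2 ^ (4n), above both n² · 4ⁿ and 4n² + 4. The two extra steps
  -- copy variable `6`, which is register 7, to register 0.
  refine ⟨ledMachine, 4, fun n => ArrStmt.ledProgram.cost n + 2, ?_, ?_⟩
  · obtain ⟨K, hK⟩ := ArrStmt.ledProgram.exists_cost_le
    refine isBigO_pow_of_le (K := K + 2) fun n => ?_
    have h1 : 1 ≤ (n + 1) ^ 5 := Nat.one_le_pow _ _ (by omega)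
    -- The nesting depth evaluates to 5: two loops over rounds around three loops over triples.
    have h2 : ArrStmt.ledProgram.cost n ≤ K * (n + 1) ^ 5 := hK n
    rw [add_mul]
    omega
  · intro α _ n e hα
    classical
    obtain ⟨Q, hQ⟩ := hα.exists_isConjugateOrder
    have hn : n < 2 ^ n := Nat.lt_two_pow_self
    have hpow : 2 ^ (4 * (n + 1)) = 16 * (2 ^ n * 2 ^ n * (2 ^ n * 2 ^ n)) := by ring
    have h1 : 1 ≤ 2 ^ n := Nat.one_le_two_pow
    have hnn : n * n ≤ 2 ^ n * 2 ^ n := Nat.mul_le_mul hn.le hn.le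
    have hsq : 2 ^ n ≤ 2 ^ n * 2 ^ n := Nat.le_mul_of_pos_right _ h1
    have hqu : 2 ^ n * 2 ^ n ≤ 2 ^ n * 2 ^ n * (2 ^ n * 2 ^ n) :=
      Nat.le_mul_of_pos_right _ (Nat.mul_pos h1 h1)
    have hnw : n * (n * (2 ^ n * 2 ^ n)) ≤ 2 ^ n * 2 ^ n * (2 ^ n * 2 ^ n) := by
      rw [← mul_assoc]
      exact Nat.mul_le_mul_right _ hnn
    have h4 : 4 * n * n = 4 * (n * n) := by ring
    set σ : ArrState := ⟨fun _ => 0, fun k a b => (posetInput e).mem ((k * n + a) * n + b)⟩ with hσ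
    have harr : ∀ (k : ℕ) (a b : Fin n), σ.arr k a b = if k = 0 ∧ e a ≤ e b then 1 else 0 := by
      intro k a b
      simp only [hσ, posetInput]
      refine if_congr ⟨?_, ?_⟩ rfl rfl
      · rintro ⟨i, j, hij, hle⟩
        -- The input matrix is exactly array `0`; a nonzero cell forces k = 0, so the other arrays
        -- start out as zero.
        have : (k * n + a) * n + b = (0 * n + i) * n + j := by rw [hij]; ring
        obtain ⟨rfl, h1, h2⟩ := (address_inj a.2 b.2 i.2 j.2).1 this
        rw [Fin.ext h1, Fin.ext h2]
        exact ⟨rfl, hle⟩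
      · rintro ⟨rfl, hle⟩
        exact ⟨a, b, by ring, hle⟩
    have henc : σ.Encodes n (posetInput e) :=
      ⟨by simp [posetInput], fun i hi => by simp [posetInput, hσ], fun _ _ _ _ _ _ => rfl⟩
    have hpo : PartiallyOriented e σ :=
      { order := fun a b => by rw [harr]; simp
        le_one := fun a b => by rw [harr]; simp
        conj := ⟨Q, hQ, fun a b h => absurd (by rw [harr]; simp) h⟩
        zero := fun k hk a b => by rw [harr, if_neg]; omega }
    have hwp := wp_ledProgram (w := 4 * (n + 1)) hpo (by omega) (by omega) (by omega)
    obtain ⟨t, s, σ', ht, hx, henc', ⟨hout, hlt⟩, -⟩ :=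
      ArrStmt.ledProgram.exec_compile (by omega) _ σ 16 _ le_rfl henc hwp
    have h7 : s.reg 7 = σ'.var 6 := henc'.var 6 (by omega)
    rw [← h7] at hlt
    refine ⟨t + (1 + 1), _, Nat.add_le_add_right ht 2, .seq hx (.seq (.const _ _ _ (by omega))
      (.op _ _ _ _ _ ?_)), ?_⟩
    · simpa [RamOp.eval] using hlt
    · simpa [RamOp.eval, h7] using hout
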